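/- For each $n\ge 1$ let $X^{(n)}$ be an irreducible continuous-time Markov chain on a finite set $\mathcal X^{(n)}$ with matrix of transition rates $Q^{(n)}$ and invariant probability measure $\pi^{(n)}$, and let $\mathcal X^{(n)}=A^{(n)}\sqcup G^{(n)}$ with $A^{(n)}$ and $G^{(n)}$ non-empty. We drop $n$ from the notation. Write $X^x$ for the chain started from $x$, and $X^{\leftarrow x}$ for the time-reversed chain, with rates $Q^{\leftarrow}(x,y)=\frac{\pi(y)}{\pi(x)}Q(y,x)$, started from $x$. For a set $K$ of states let $\tau^x_K=\inf\{t\ge0: X^x_t\in K\}$, and let $\tau^{\leftarrow x}_K$ be the corresponding hitting time of $X^{\leftarrow x}$. For a probability measure $\nu$ on $\mathcal X$, $\tau^\nu_K$ denotes the hitting time from the initial law $\nu$, so that $\mathbf P(\tau^\nu_K\le t)=\sum_x\nu(x)\mathbf P(\tau^x_K\le t)$ and $\mathbf E[\tau^\nu_K]=\sum_x\nu(x)\mathbf E[\tau^x_K]$. Let $\pi_A=\pi(\cdot\cap A)/\pi(A)$, and let the quasi-stationary measure on $A$ be $$\mu^*_A(y):=\lim_{t\to\infty}\sum_{x\in A}\pi_A(x)\,\mathbf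 P(X^x_t=y\mid \tau^x_G>t).$$ Fix $\alpha\in(0,1)$. For $R>1$ and $f\in(0,1)$ put $$B_\alpha:=\Big\{x\in A:\ \tfrac12\big[\mathbf P(\tau^x_G\le 2R)+\mathbf P(\tau^{\leftarrow x}_G\le 2R)\big]\le f^\alpha\Big\}.$$ Suppose that there are sequences $R=R_n>1$ and $d=d_n$, $f=f_n$, $r=r_n$ in $(0,1)$, with $d_n,f_n,r_n\to0$ as $n\to\infty$, such that for every $n$ condition $Hp.G(R,d,f,r)$ holds, that is: * (slow escape) $\mathbf P(\tau^{\pi_A}_G\le 2R)\le f$; * (fast thermalization) $\frac12\sum_{y\in\mathcal X}\big|\mathbf P(X^x_R=y)-\mathbf P(X^{x'}_R=y)\big|\le d$ for all $x,x'\in B_\alpha$; * (fast recurrence) $\sup_{x\in\mathcal X}\mathbf P(\tau^x_{B_\alpha\cup G}>R)<r$. Then, for every $n$, the limit defining $\mu^*_A$ exists, and for any choice of points $x=x_n\in B_\alpha^{(n)}$, $$\mathbf E[\tau^{\mu^*_A}_G]\ \sim\ \mathbf E[\tau^{\pi_A}_G]\ \sim\ \mathbf E[\tau^x_G]\qquad(n\to\infty),$$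 where $a_n\sim b_n$ means $\lim_{n\to\infty}a_n/b_n=1$. -/

import Mathlib

open Filter Topology MeasureTheory
open scoped NNReal ENNReal

noncomputable section

/-- A matrix of transition rates: non-negative off the diagonal, with zero row sums. -/
structure IsRateMatrix {S : Type*} [Fintype S] (Q : Matrix S S ℝ) : Prop where
  nonneg : ∀ x y, x ≠ y → 0 ≤ Q x y
  row_sum : ∀ x, ∑ y, Q x y = 0

/-- Every state can be reached from every other one along transitions of positive rate. -/
def IsIrreducibleRate {S : Type*} (Q : Matrix S S ℝ) : Prop :=
  ∀ x y, Relation.ReflTransGen (fun a b => 0 < Q a b) x y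

/-- `m` is an invariant probability measure of the chain with rates `Q`. -/
structure IsInvariantProb {S : Type*} [Fintype S] (Q : Matrix S S ℝ) (m : S → ℝ) : Prop where
  nonneg : ∀ x, 0 ≤ m x
  sum_one : ∑ x, m x = 1
  invariant : ∀ y, ∑ x, m x * Q x y = 0

/-- The rates `m(y) Q(y,x) / m(x)` of the time reversal with respect to `m`. -/
def reversedRate {S : Type*} (Q : Matrix S S ℝ) (m : S → ℝ) : Matrix S S ℝ :=
  Matrix.of fun x y => m y / m x * Q y x

/-- The semigroup `exp (t Q)`. -/
def semigroup {S : Type*} [Fintype S] [DecidableEq S] (Q : Matrix S S ℝ) (t : ℝ≥0) :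
    Matrix S S ℝ :=
  NormedSpace.exp ((t : ℝ) • Q)

/-- `X` is, under `P`, a continuous time Markov chain with rates `Q` started from `x`: its paths
are right-continuous (for the discrete topology) and its finite-dimensional distributions are
those given by the semigroup `exp (t Q)`. -/
structure IsMarkovChainFrom {S Ω : Type*} [Fintype S] [DecidableEq S] [MeasurableSpace Ω]
    (Q : Matrix S S ℝ) (x : S) (P : Measure Ω) (X : ℝ≥0 → Ω → S) : Prop where
  measurable : ∀ t y, MeasurableSet {ω | X t ω = y}
  right_continuous : ∀ ω t, ∀ᶠ s in 𝓝[≥] t, X s ω = X t ω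
  finite_dim : ∀ (k : ℕ) (t : Fin (k + 1) → ℝ≥0) (y : Fin (k + 1) → S),
    Monotone t → t 0 = 0 → y 0 = x →
      P {ω | ∀ i, X (t i) ω = y i} =
        ENNReal.ofReal
          (∏ i : Fin k, semigroup Q (t i.succ - t i.castSucc) (y i.castSucc) (y i.succ))

/-- The first hitting time `inf {t ≥ 0 : X_t ∈ K}`, equal to `∞` if `K` is never hit. -/
def hittingTime {S Ω : Type*} (X : ℝ≥0 → Ω → S) (K : Set S) (ω : Ω) : ℝ≥0∞ :=
  ⨅ (t : ℝ≥0) (_ : X t ω ∈ K), (t : ℝ≥0∞)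

/-- Total variation distance of two measures on a finite set, given by their weights. -/
def tvDist {S : Type*} [Fintype S] (p q : S → ℝ) : ℝ :=
  (1 / 2) * ∑ x, |p x - q x|

/-- An irreducible continuous time Markov chain on the finite set `S`, with rates `Q` and
invariant measure `stat`, together with a set `A`, neither empty nor everything. On the
probability space `(Ω, P)`, `X x` is the chain started from `x` and `Xrev x` is the time reversed
chain started from `x`. -/
structure TrappedChain (S Ω : Type*) [Fintype S] [DecidableEq S] [MeasurableSpace Ω] where
  Q : Matrix S S ℝ
  rate : IsRateMatrix Q
  irreducible : IsIrreducibleRate Q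
  stat : S → ℝ
  invariant : IsInvariantProb Q stat
  P : Measure Ω
  prob : IsProbabilityMeasure P
  X : S → ℝ≥0 → Ω → S
  chain : ∀ x, IsMarkovChainFrom Q x P (X x)
  Xrev : S → ℝ≥0 → Ω → S
  chain_rev : ∀ x, IsMarkovChainFrom (reversedRate Q stat) x P (Xrev x)
  A : Set S
  A_nonempty : A.Nonempty
  compl_nonempty : Aᶜ.Nonempty

namespace TrappedChain

variable {S Ω : Type*} [Fintype S] [DecidableEq S] [MeasurableSpace Ω]

/-- The set of goals, the complement of `A`. -/
def G (M : TrappedChain S Ω) : Set S := M.Aᶜ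

/-- The invariant measure restricted to `A` and normalized, `π_A`. -/
def restricted (M : TrappedChain S Ω) (y : S) : ℝ :=
  M.A.indicator M.stat y / ∑ z, M.A.indicator M.stat z

/-- The evolved measure `μ^x_t(y) = P(X^x_t = y)`. -/
def evolved (M : TrappedChain S Ω) (x : S) (t : ℝ≥0) (y : S) : ℝ :=
  M.P.real {ω | M.X x t ω = y}

/-- The conditioned evolution measure `P(X^x_t = y | τ^x_G > t)`. -/
def conditioned (M : TrappedChain S Ω) (x : S) (t : ℝ≥0) (y : S) : ℝ :=
  M.P.real {ω | M.X x t ω = y ∧ (t : ℝ≥0∞) < hittingTime (M.X x) M.G ω} /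
    M.P.real {ω | (t : ℝ≥0∞) < hittingTime (M.X x) M.G ω}

/-- The conditioned evolution measure for the initial measure `ν`: the `ν`-mixture of the
conditioned evolution measures of the initial points. -/
def conditionedFrom (M : TrappedChain S Ω) (ν : S → ℝ) (t : ℝ≥0) (y : S) : ℝ :=
  ∑ x, ν x * M.conditioned x t y

/-- The quasi-stationary measure `μ*_A`, the limit as `t → ∞` of the conditioned evolution
measure with initial measure `π_A`. -/
def quasiStationary (M : TrappedChain S Ω) (y : S) : ℝ :=
  limUnder atTop fun t : ℝ≥0 => M.conditionedFrom M.restricted t y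

/-- The mean hitting time `E[τ^x_G]`. -/
def meanExit (M : TrappedChain S Ω) (x : S) : ℝ≥0∞ :=
  ∫⁻ ω, hittingTime (M.X x) M.G ω ∂M.P

/-- The mean hitting time `E[τ^ν_G]` for the initial measure `ν`. -/
def meanExitFrom (M : TrappedChain S Ω) (ν : S → ℝ) : ℝ≥0∞ :=
  ∑ x, ENNReal.ofReal (ν x) * M.meanExit x

/-- `f_A(t) = P(τ^{π_A}_G ≤ t)`. -/
def escapeProb (M : TrappedChain S Ω) (t : ℝ≥0) : ℝ :=
  ∑ x, M.restricted x * M.P.real {ω | hittingTime (M.X x) M.G ω ≤ (t : ℝ≥0∞)}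

/-- The basin `B_α`: the points `x` of `A` with
`(P(τ^x_G ≤ 2R) + P(τ^{←x}_G ≤ 2R)) / 2 ≤ f ^ α`. -/
def basin (M : TrappedChain S Ω) (R : ℝ≥0) (f α : ℝ) : Set S :=
  {x | x ∈ M.A ∧
    (1 / 2) * (M.P.real {ω | hittingTime (M.X x) M.G ω ≤ ((2 * R : ℝ≥0) : ℝ≥0∞)} +
      M.P.real {ω | hittingTime (M.Xrev x) M.G ω ≤ ((2 * R : ℝ≥0) : ℝ≥0∞)}) ≤ f ^ α}

/-- Slow escape `E(R,f)`. -/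
def SlowEscape (M : TrappedChain S Ω) (R : ℝ≥0) (f : ℝ) : Prop :=
  M.escapeProb (2 * R) ≤ f

/-- Fast thermalization `T(R,d)` in the basin. -/
def FastThermalization (M : TrappedChain S Ω) (R : ℝ≥0) (d f α : ℝ) : Prop :=
  ∀ x ∈ M.basin R f α, ∀ x' ∈ M.basin R f α, tvDist (M.evolved x R) (M.evolved x' R) ≤ d

/-- Fast recurrence `Rc(R,r)` to the basin or to the goals. The state space is finite, so
that the supremum over `x` of the probabilities is less than `r` iff all of them are. -/
def FastRecurrence (M : TrappedChain S Ω) (R : ℝ≥0) (r f α : ℝ) : Prop :=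
  ∀ x, M.P.real {ω | (R : ℝ≥0∞) < hittingTime (M.X x) (M.basin R f α ∪ M.G) ω} < r

/-- The condition `Hp.G(R,d,f,r)`, for the exponent `α`. -/
structure HpG (M : TrappedChain S Ω) (R : ℝ≥0) (d f r α : ℝ) : Prop where
  one_lt_R : 1 < R
  d_mem : d ∈ Set.Ioo (0 : ℝ) 1
  f_mem : f ∈ Set.Ioo (0 : ℝ) 1
  r_mem : r ∈ Set.Ioo (0 : ℝ) 1
  slow_escape : M.SlowEscape R f
  fast_thermalization : M.FastThermalization R d f α
  fast_recurrence : M.FastRecurrence R r f α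

end TrappedChain

end

/-! Let `h x` be the mean hitting time of `G` from `x`, and let `H` be its maximum over all states.
The theorem follows once `h` is nearly `H` on the basin `B`, and the means of `h` under `π_A` and
under `μ*_A` are nearly `H` too.

The time `R` is negligible against `H`. By slow escape, `π_A` loses mass at most `f` up to time
`2R`, and `π_A` is subinvariant for the chain killed on `G`, so `2R(1 - f) ≤ f H`
(`IsMeanTime.mul_le_of_slow_escape`). Fast recurrence brings the chain from a maximizer of `h` to `B
∪ G` within time `R`, so the maximum of `h` over `B` is at least `H - R/(1 - r)`
(`IsMeanTime.le_of_recurrence`). Fast thermalization, with the small escape probability from points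
of `B`, bounds the oscillation of `h` on `B` by `R + (2 f^α + d) H` (`IsMeanTime.sub_le_of_mixing`).
Hence `h ≥ (1 - δ) H` on `B`, with `δ` tending to zero.

The mean under `π_A` is close to `H` because `π_A(B) ≥ 1 - f^(1-α)`. This is Markov's inequality:
the quantity defining `B` has `π_A`-mean equal to the escape probability, since the reversed chain
escapes from `π_A` with the same probability as the chain itself (`le_sum_restricted_basin`).

For `μ*_A`, each row of the killed semigroup, once normalized, converges to a left eigenvector `ν x`
with some eigenvalue `s x` (`IsMetzler.exists_tendsto_normalized_row`); no irreducibility inside `A`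
is needed. Thus `μ*_A` exists and is the `π_A`-mixture of the `ν x`. For `x` in `B` the chain keeps
returning to `B` before escaping, so survival decays at most like `(1 - 2 f^α - r)^k` at time `kR`,
whence `exp (s x * R) ≥ 1 - 2 f^α - r`. Started from `ν x`, the chain therefore reaches `B` before
`G` with probability at least `1 - 2 f^α - 2 r`, and the mean of `h` under `ν x` is nearly `H`.

All estimates are made on the killed semigroup. The link with the paths is
`IsMarkovChainFrom.measureReal_eq_and_lt_hittingTime`, obtained by observing the chain on dyadic
grids. -/

/-! ### Exponentials of matrices with non-negative off-diagonal entries. -/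

section MatrixFlow

open Matrix
open scoped Matrix.Norms.Operator

variable {S : Type*} [Fintype S]

/-- Matrices with non-negative off-diagonal entries. -/
def IsMetzler {S : Type*} (L : Matrix S S ℝ) : Prop := ∀ x y, x ≠ y → 0 ≤ L x y

lemma Matrix.mulVec_mono {E : Matrix S S ℝ} (hE : ∀ x y, 0 ≤ E x y) {g g' : S → ℝ}
    (h : ∀ y, g y ≤ g' y) (x : S) : (E *ᵥ g) x ≤ (E *ᵥ g') x :=
  Finset.sum_le_sum fun y _ => mul_le_mul_of_nonneg_left (h y) (hE x y)

lemma Matrix.mulVec_nonneg' {E : Matrix S S ℝ} (hE : ∀ x y, 0 ≤ E x y) {g : S → ℝ}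
    (h : ∀ y, 0 ≤ g y) (x : S) : 0 ≤ (E *ᵥ g) x :=
  Finset.sum_nonneg fun y _ => mul_nonneg (hE x y) (h y)

variable [DecidableEq S]

lemma Matrix.exp_apply_nonneg_of_nonneg (N : Matrix S S ℝ) (hN : ∀ x y, 0 ≤ N x y) (x y : S) :
    0 ≤ NormedSpace.exp N x y := by
  have hpow : ∀ k : ℕ, ∀ x y, 0 ≤ (N ^ k) x y := by
    intro k
    induction k with
    | zero => intro x y; rw [pow_zero, Matrix.one_apply]; split_ifs <;> norm_num
    | succ k ih =>
      intro x y
      rw [pow_succ, Matrix.mul_apply]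
      exact Finset.sum_nonneg fun z _ => mul_nonneg (ih x z) (hN z y)
  have h := NormedSpace.exp_series_hasSum_exp' (𝕂 := ℝ) N
  have h2 := (Pi.hasSum.1 (Pi.hasSum.1 h x)) y
  refine h2.nonneg fun k => ?_
  rw [Matrix.smul_apply, smul_eq_mul]
  exact mul_nonneg (by positivity) (hpow k x y)

lemma IsMetzler.exists_shift {L : Matrix S S ℝ} (hL : IsMetzler L) :
    ∃ c : ℝ, ∀ x y, 0 ≤ (L + c • (1 : Matrix S S ℝ)) x y := by
  refine ⟨∑ z, |L z z|, fun x y => ?_⟩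
  rw [Matrix.add_apply, Matrix.smul_apply, Matrix.one_apply]
  split_ifs with h
  · subst h
    have h1 : |L x x| ≤ ∑ z, |L z z| :=
      Finset.single_le_sum (f := fun z => |L z z|) (fun z _ => abs_nonneg _) (Finset.mem_univ x)
    have h2 := neg_abs_le (L x x)
    simp only [smul_eq_mul, mul_one]
    linarith
  · simpa using hL x y h

/-- Adding a multiple `c` of the identity makes `L` entrywise non-negative, and costs only the
positive scalar factor `exp (-(t * c))` in the exponential. -/
lemma IsMetzler.exp_nonneg {L : Matrix S S ℝ} (hL : IsMetzler L) {t : ℝ} (ht : 0 ≤ t) (x y : S) :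
    0 ≤ NormedSpace.exp (t • L) x y := by
  obtain ⟨c, hc⟩ := hL.exists_shift
  have h1 : t • L = t • (L + c • (1 : Matrix S S ℝ)) + algebraMap ℝ (Matrix S S ℝ) (-(t * c)) := by
    rw [Algebra.algebraMap_eq_smul_one, smul_add, smul_smul, neg_smul]
    abel
  have h2 : NormedSpace.exp (algebraMap ℝ (Matrix S S ℝ) (-(t * c))) =
      Real.exp (-(t * c)) • (1 : Matrix S S ℝ) := by
    rw [Real.exp_eq_exp_ℝ, ← Algebra.algebraMap_eq_smul_one]
    exact (NormedSpace.algebraMap_exp_comm (𝔸 := Matrix S S ℝ) (-(t * c))).symm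
  rw [h1, Matrix.exp_add_of_commute _ _ (Algebra.commute_algebraMap_right _ _), h2,
    mul_smul_comm, mul_one, Matrix.smul_apply, smul_eq_mul]
  refine mul_nonneg (Real.exp_pos _).le (Matrix.exp_apply_nonneg_of_nonneg _ (fun x y => ?_) x y)
  rw [Matrix.smul_apply, smul_eq_mul]
  exact mul_nonneg ht (hc x y)

lemma Matrix.exp_add_smul (L : Matrix S S ℝ) (s t : ℝ) :
    NormedSpace.exp ((s + t) • L) = NormedSpace.exp (s • L) * NormedSpace.exp (t • L) := by
  rw [add_smul]
  exact Matrix.exp_add_of_commute _ _ (((Commute.refl L).smul_left s).smul_right t)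

lemma Matrix.mul_exp_comm (L : Matrix S S ℝ) (t : ℝ) :
    L * NormedSpace.exp (t • L) = NormedSpace.exp (t • L) * L :=
  (((Commute.refl L).smul_right t).exp_right).eq

lemma Matrix.hasDerivAt_exp_apply (L : Matrix S S ℝ) (t : ℝ) (x y : S) :
    HasDerivAt (fun t : ℝ => NormedSpace.exp (t • L) x y) ((NormedSpace.exp (t • L) * L) x y) t :=
  hasDerivAt_pi.1 (hasDerivAt_pi.1 (hasDerivAt_exp_smul_const L t) x) y

lemma Matrix.hasDerivAt_exp_mulVec (L : Matrix S S ℝ) (g : S → ℝ) (t : ℝ) (x : S) :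
    HasDerivAt (fun t : ℝ => (NormedSpace.exp (t • L) *ᵥ g) x)
      ((NormedSpace.exp (t • L) *ᵥ (L *ᵥ g)) x) t := by
  rw [Matrix.mulVec_mulVec]
  simp only [Matrix.mulVec, dotProduct]
  exact HasDerivAt.fun_sum fun y _ => (Matrix.hasDerivAt_exp_apply L t x y).mul_const (g y)

lemma Matrix.exp_zero_smul (L : Matrix S S ℝ) : NormedSpace.exp ((0 : ℝ) • L) = 1 := by
  rw [zero_smul, NormedSpace.exp_zero]

/-- Comparison principle for the linear differential inequality `z' ≥ L z`. -/
lemma IsMetzler.comparison {L : Matrix S S ℝ} (hL : IsMetzler L) {z z' : ℝ → S → ℝ} {T : ℝ}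
    (hT : 0 ≤ T) (hz : ∀ t x, HasDerivAt (fun t => z t x) (z' t x) t)
    (hz' : ∀ t, 0 ≤ t → ∀ x, (L *ᵥ z t) x ≤ z' t x) (h0 : ∀ x, 0 ≤ z 0 x) (x : S) : 0 ≤ z T x := by
  -- Duhamel interpolation: `φ 0` is a positive matrix applied to `z 0`, `φ T = z T x`, and the
  -- differential inequality makes `φ` increasing.
  set φ : ℝ → ℝ := fun t => (NormedSpace.exp ((T - t) • L) *ᵥ z t) x with hφ
  have hd : ∀ t, HasDerivAt φ ((NormedSpace.exp ((T - t) • L) *ᵥ (z' t - L *ᵥ z t)) x) t := by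
    intro t
    have h1 : ∀ y, HasDerivAt (fun t : ℝ => NormedSpace.exp ((T - t) • L) x y)
        (-(NormedSpace.exp ((T - t) • L) * L) x y) t := by
      intro y
      have h2 := (Matrix.hasDerivAt_exp_apply L (T - t) x y).scomp t
        ((hasDerivAt_id t).const_sub T)
      simp only [neg_smul, one_smul] at h2
      exact h2
    have h3 : HasDerivAt φ (∑ y, (-(NormedSpace.exp ((T - t) • L) * L) x y * z t y +
        NormedSpace.exp ((T - t) • L) x y * z' t y)) t := by
      rw [hφ]
      simp only [Matrix.mulVec, dotProduct]
      exact HasDerivAt.fun_sum fun y _ => (h1 y).mul (hz t y)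
    convert h3 using 1
    rw [Matrix.mulVec_sub, Matrix.mulVec_mulVec, Pi.sub_apply, Finset.sum_add_distrib]
    simp only [Matrix.mulVec, dotProduct, neg_mul, Finset.sum_neg_distrib]
    ring
  have hmono : MonotoneOn φ (Set.Icc 0 T) := by
    refine monotoneOn_of_deriv_nonneg (convex_Icc 0 T)
      (fun t _ => (hd t).continuousAt.continuousWithinAt)
      (fun t _ => (hd t).differentiableAt.differentiableWithinAt) fun t ht => ?_
    rw [interior_Icc] at ht
    rw [(hd t).deriv]
    exact Matrix.mulVec_nonneg' (hL.exp_nonneg (by linarith [ht.2]))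
      (fun y => sub_nonneg.2 (hz' t ht.1.le y)) x
  have h1 := hmono (Set.left_mem_Icc.2 hT) (Set.right_mem_Icc.2 hT) hT
  have h2 : φ T = z T x := by simp [hφ, Matrix.one_mulVec]
  rw [← h2]
  refine le_trans ?_ h1
  exact Matrix.mulVec_nonneg' (hL.exp_nonneg (by simpa using hT)) h0 x

/-- The derivative of the exponential is `L * exp (t • L)`, whose row `x` vanishes. The column
version below writes it as `exp (t • L) * L` instead. Applied to the killed rates, both say that the
semigroup is the identity on the killed set. -/
lemma Matrix.exp_apply_eq_one_of_row_eq_zero (L : Matrix S S ℝ) {x : S} (h : ∀ y, L x y = 0)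
    (t : ℝ) (y : S) : NormedSpace.exp (t • L) x y = (1 : Matrix S S ℝ) x y := by
  have hd : ∀ s : ℝ, HasDerivAt (fun t : ℝ => NormedSpace.exp (t • L) x y) 0 s := by
    intro s
    have := Matrix.hasDerivAt_exp_apply L s x y
    rw [← Matrix.mul_exp_comm, Matrix.mul_apply] at this
    simpa [h] using this
  have := is_const_of_deriv_eq_zero (fun s => (hd s).differentiableAt) (fun s => (hd s).deriv) t 0
  simpa using this

lemma Matrix.exp_apply_eq_one_of_col_eq_zero (L : Matrix S S ℝ) {y : S} (h : ∀ x, L x y = 0)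
    (t : ℝ) (x : S) : NormedSpace.exp (t • L) x y = (1 : Matrix S S ℝ) x y := by
  have hd : ∀ s : ℝ, HasDerivAt (fun t : ℝ => NormedSpace.exp (t • L) x y) 0 s := by
    intro s
    have := Matrix.hasDerivAt_exp_apply L s x y
    rw [Matrix.mul_apply] at this
    simpa [h] using this
  have := is_const_of_deriv_eq_zero (fun s => (hd s).differentiableAt) (fun s => (hd s).deriv) t 0
  simpa using this

lemma Matrix.vecMul_exp_of_eigen {L : Matrix S S ℝ} {ν : S → ℝ} {s : ℝ} (h : ν ᵥ* L = s • ν)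
    (t : ℝ) (y : S) : (ν ᵥ* NormedSpace.exp (t • L)) y = Real.exp (s * t) * ν y := by
  have hd : ∀ u : ℝ, HasDerivAt
      (fun u : ℝ => Real.exp (-(s * u)) * (ν ᵥ* NormedSpace.exp (u • L)) y) 0 u := by
    intro u
    have h1 : HasDerivAt (fun u : ℝ => (ν ᵥ* NormedSpace.exp (u • L)) y)
        (s * (ν ᵥ* NormedSpace.exp (u • L)) y) u := by
      have h2 : s * (ν ᵥ* NormedSpace.exp (u • L)) y =
          (ν ᵥ* (NormedSpace.exp (u • L) * L)) y := by
        rw [← Matrix.mul_exp_comm, ← Matrix.vecMul_vecMul, h, Matrix.smul_vecMul]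
        rfl
      rw [h2]
      simp only [Matrix.vecMul, dotProduct]
      exact HasDerivAt.fun_sum fun x _ => (Matrix.hasDerivAt_exp_apply L u x y).const_mul (ν x)
    have h3 : HasDerivAt (fun u : ℝ => Real.exp (-(s * u))) (Real.exp (-(s * u)) * (-s)) u := by
      have := ((hasDerivAt_id u).const_mul s).neg.exp
      simpa using this
    have := h3.mul h1
    refine this.congr_deriv ?_
    ring
  have h4 := is_const_of_deriv_eq_zero (fun s => (hd s).differentiableAt) (fun s => (hd s).deriv) t 0
  simp only [mul_zero, neg_zero, Real.exp_zero, one_mul, Matrix.exp_zero_smul,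
    Matrix.vecMul_one] at h4
  rw [← h4, ← mul_assoc, ← Real.exp_add]
  simp

end MatrixFlow

/-! ### Killed generators, survival probabilities and mean hitting times. -/

section Killed

open Matrix
open scoped Matrix.Norms.Operator

variable {S : Type*}

/-- The rates `Q` killed on `K`: all transitions from and to `K` are suppressed, while the exit
rates outside `K` are kept. -/
noncomputable def killed (Q : Matrix S S ℝ) (K : Set S) : Matrix S S ℝ :=
  Matrix.of fun x y => Kᶜ.indicator (fun x => Kᶜ.indicator (Q x) y) x

lemma killed_apply_of_notMem (Q : Matrix S S ℝ) {K : Set S} {x y : S} (hx : x ∉ K) (hy : y ∉ K) :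
    killed Q K x y = Q x y := by
  simp [killed, hx, hy]

lemma killed_apply_of_mem_left (Q : Matrix S S ℝ) {K : Set S} {x : S} (hx : x ∈ K) (y : S) :
    killed Q K x y = 0 := by
  simp [killed, hx]

lemma killed_apply_of_mem_right (Q : Matrix S S ℝ) {K : Set S} {y : S} (hy : y ∈ K) (x : S) :
    killed Q K x y = 0 := by
  by_cases hx : x ∈ K <;> simp [killed, hx, hy]

lemma killed_empty (Q : Matrix S S ℝ) : killed Q ∅ = Q := by
  ext x y
  exact killed_apply_of_notMem Q (by simp) (by simp)

variable [Fintype S]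

lemma IsRateMatrix.isMetzler {Q : Matrix S S ℝ} (hQ : IsRateMatrix Q) : IsMetzler Q := hQ.nonneg

lemma IsRateMatrix.isMetzler_killed {Q : Matrix S S ℝ} (hQ : IsRateMatrix Q) (K : Set S) :
    IsMetzler (killed Q K) := by
  intro x y hxy
  by_cases hx : x ∈ K
  · rw [killed_apply_of_mem_left Q hx]
  by_cases hy : y ∈ K
  · rw [killed_apply_of_mem_right Q hy]
  rw [killed_apply_of_notMem Q hx hy]
  exact hQ.nonneg x y hxy

lemma killed_mulVec_of_mem (Q : Matrix S S ℝ) {K : Set S} (g : S → ℝ) {x : S} (hx : x ∈ K) :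
    (killed Q K *ᵥ g) x = 0 := by
  simp [Matrix.mulVec, dotProduct, killed_apply_of_mem_left Q hx]

lemma killed_mulVec_of_notMem (Q : Matrix S S ℝ) {K : Set S} (g : S → ℝ) {x : S} (hx : x ∉ K) :
    (killed Q K *ᵥ g) x = ∑ y, Q x y * Kᶜ.indicator g y := by
  simp only [Matrix.mulVec, dotProduct]
  refine Finset.sum_congr rfl fun y _ => ?_
  by_cases hy : y ∈ K
  · simp [killed_apply_of_mem_right Q hy, hy]
  · simp [killed_apply_of_notMem Q hx hy, hy]

lemma IsRateMatrix.sum_indicator_nonpos {Q : Matrix S S ℝ} (hQ : IsRateMatrix Q) {K : Set S} {x : S}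
    (hx : x ∉ K) : ∑ y, Q x y * Kᶜ.indicator (fun _ => (1 : ℝ)) y ≤ 0 := by
  rw [← hQ.row_sum x]
  refine Finset.sum_le_sum fun y _ => ?_
  by_cases hy : y ∈ K
  · simpa [hy] using hQ.nonneg x y (by rintro rfl; exact hx hy)
  · simp [hy]

lemma IsRateMatrix.killed_mulVec_one_nonpos {Q : Matrix S S ℝ} (hQ : IsRateMatrix Q) (K : Set S)
    (x : S) : (killed Q K *ᵥ Kᶜ.indicator fun _ => (1 : ℝ)) x ≤ 0 := by
  by_cases hx : x ∈ K
  · rw [killed_mulVec_of_mem Q _ hx]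
  · rw [killed_mulVec_of_notMem Q _ hx, Set.indicator_indicator, Set.inter_self]
    exact hQ.sum_indicator_nonpos hx

variable [DecidableEq S]

lemma exp_killed_apply_of_mem_left (Q : Matrix S S ℝ) {K : Set S} {x : S} (hx : x ∈ K) (t : ℝ)
    (y : S) : NormedSpace.exp (t • killed Q K) x y = (1 : Matrix S S ℝ) x y :=
  Matrix.exp_apply_eq_one_of_row_eq_zero _ (killed_apply_of_mem_left Q hx) t y

lemma exp_killed_apply_of_mem_right (Q : Matrix S S ℝ) {K : Set S} {y : S} (hy : y ∈ K) (t : ℝ)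
    (x : S) : NormedSpace.exp (t • killed Q K) x y = (1 : Matrix S S ℝ) x y :=
  Matrix.exp_apply_eq_one_of_col_eq_zero _ (killed_apply_of_mem_right Q hy) t x

lemma exp_killed_mulVec_of_mem (Q : Matrix S S ℝ) {K : Set S} {x : S} (hx : x ∈ K) (t : ℝ)
    (g : S → ℝ) : (NormedSpace.exp (t • killed Q K) *ᵥ g) x = g x := by
  simp [Matrix.mulVec, dotProduct, exp_killed_apply_of_mem_left Q hx, Matrix.one_apply]

/-- The probability that the chain with rates `Q` started from `x` avoids `K` up to time `t`. -/
noncomputable def survival (Q : Matrix S S ℝ) (K : Set S) (t : ℝ) (x : S) : ℝ :=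
  (NormedSpace.exp (t • killed Q K) *ᵥ Kᶜ.indicator fun _ => (1 : ℝ)) x

lemma survival_of_mem (Q : Matrix S S ℝ) {K : Set S} {x : S} (hx : x ∈ K) (t : ℝ) :
    survival Q K t x = 0 := by
  rw [survival, exp_killed_mulVec_of_mem Q hx]
  simp [hx]

lemma survival_zero (Q : Matrix S S ℝ) (K : Set S) (x : S) :
    survival Q K 0 x = Kᶜ.indicator (fun _ => (1 : ℝ)) x := by
  simp [survival]

lemma hasDerivAt_survival (Q : Matrix S S ℝ) (K : Set S) (t : ℝ) (x : S) :
    HasDerivAt (fun t => survival Q K t x) ((killed Q K *ᵥ survival Q K t) x) t := by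
  refine (Matrix.hasDerivAt_exp_mulVec (killed Q K) _ t x).congr_deriv ?_
  have h : survival Q K t =
      NormedSpace.exp (t • killed Q K) *ᵥ Kᶜ.indicator fun _ => (1 : ℝ) := rfl
  rw [h, Matrix.mulVec_mulVec, Matrix.mulVec_mulVec, Matrix.mul_exp_comm]

lemma survival_add (Q : Matrix S S ℝ) (K : Set S) (s t : ℝ) (x : S) :
    survival Q K (s + t) x = (NormedSpace.exp (s • killed Q K) *ᵥ survival Q K t) x := by
  have h : survival Q K t =
      NormedSpace.exp (t • killed Q K) *ᵥ Kᶜ.indicator fun _ => (1 : ℝ) := rfl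
  rw [h, Matrix.mulVec_mulVec, ← Matrix.exp_add_smul]
  rfl

variable {Q : Matrix S S ℝ}

lemma IsRateMatrix.survival_nonneg (hQ : IsRateMatrix Q) (K : Set S) {t : ℝ} (ht : 0 ≤ t) (x : S) :
    0 ≤ survival Q K t x :=
  Matrix.mulVec_nonneg' ((hQ.isMetzler_killed K).exp_nonneg ht)
    (fun y => Set.indicator_nonneg (fun _ _ => zero_le_one) y) x

/-- The generator commutes with its exponential and sends the indicator of the complement of `K` to
a non-positive function; positivity of the semigroup does the rest. This gives monotonicity in time,
and makes survival probabilities superharmonic functions for `IsRateMatrix.superharmonic_ge`. -/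
lemma IsRateMatrix.deriv_survival_nonpos (hQ : IsRateMatrix Q) (K : Set S) {t : ℝ} (ht : 0 ≤ t)
    (x : S) : (killed Q K *ᵥ survival Q K t) x ≤ 0 := by
  have h : survival Q K t =
      NormedSpace.exp (t • killed Q K) *ᵥ Kᶜ.indicator fun _ => (1 : ℝ) := rfl
  rw [h, Matrix.mulVec_mulVec, Matrix.mul_exp_comm, ← Matrix.mulVec_mulVec]
  have h1 := Matrix.mulVec_mono ((hQ.isMetzler_killed K).exp_nonneg ht)
    (g' := 0) (hQ.killed_mulVec_one_nonpos K) x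
  simpa using h1

lemma IsRateMatrix.survival_antitone (hQ : IsRateMatrix Q) (K : Set S) {s t : ℝ} (hs : 0 ≤ s)
    (hst : s ≤ t) (x : S) : survival Q K t x ≤ survival Q K s x := by
  have h : AntitoneOn (fun t => survival Q K t x) (Set.Ici 0) := by
    refine antitoneOn_of_deriv_nonpos (convex_Ici 0)
      (fun t _ => (hasDerivAt_survival Q K t x).continuousAt.continuousWithinAt)
      (fun t _ => (hasDerivAt_survival Q K t x).differentiableAt.differentiableWithinAt)
      fun t ht => ?_
    rw [interior_Ici] at ht
    rw [(hasDerivAt_survival Q K t x).deriv]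
    exact hQ.deriv_survival_nonpos K (le_of_lt ht) x
  exact h hs (hs.trans hst) hst

lemma IsRateMatrix.survival_le_one (hQ : IsRateMatrix Q) (K : Set S) {t : ℝ} (ht : 0 ≤ t) (x : S) :
    survival Q K t x ≤ 1 := by
  refine (hQ.survival_antitone K le_rfl ht x).trans ?_
  rw [survival_zero]
  exact Set.indicator_le_self' (fun _ _ => zero_le_one) x

/-- A function which vanishes on `K` and whose generator is `-1` off `K`. -/
structure IsMeanTime (Q : Matrix S S ℝ) (K : Set S) (h : S → ℝ) : Prop where
  eq_zero : ∀ x ∈ K, h x = 0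
  generator : ∀ x, (killed Q K *ᵥ h) x = -Kᶜ.indicator (fun _ => (1 : ℝ)) x

/-- Maximum principle: a function which vanishes on `K` and is harmonic off `K` is non-positive. -/
lemma IsRateMatrix.harmonic_nonpos (hQ : IsRateMatrix Q) (hirr : IsIrreducibleRate Q) {K : Set S}
    (hK : K.Nonempty) {z : S → ℝ} (hz : ∀ x ∈ K, z x = 0)
    (hLz : ∀ x, x ∉ K → (killed Q K *ᵥ z) x = 0) (x : S) : z x ≤ 0 := by
  have hne : Nonempty S := ⟨x⟩
  obtain ⟨m, hm⟩ := Finite.exists_max z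
  by_contra! hpos
  have hzm : 0 < z m := hpos.trans_le (hm x)
  -- At a maximum point off `K`, the generator is a sum of terms of one sign with total zero, so the
  -- maximum propagates along positive rates. By irreducibility it reaches `K`, where `z` vanishes.
  have hstep : ∀ a b, z a = z m → 0 < Q a b → z b = z m := by
    intro a b ha hab
    have haK : a ∉ K := fun h => by rw [hz a h] at ha; linarith
    have h1 := hLz a haK
    rw [killed_mulVec_of_notMem Q _ haK] at h1
    have h2 : Kᶜ.indicator z = z := by
      rw [Set.indicator_eq_self]
      intro y hy hyK
      exact hy (hz y hyK)
    rw [h2] at h1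
    have h3 : ∑ y, Q a y * (z m - z y) = 0 := by
      simp only [mul_sub, Finset.sum_sub_distrib, h1, ← Finset.sum_mul, hQ.row_sum]
      simp
    have h4 : ∀ y ∈ Finset.univ, 0 ≤ Q a y * (z m - z y) := by
      intro y _
      by_cases hy : a = y
      · subst hy; rw [ha]; simp
      · exact mul_nonneg (hQ.nonneg a y hy) (sub_nonneg.2 (hm y))
    have h5 := (Finset.sum_eq_zero_iff_of_nonneg h4).1 h3 b (Finset.mem_univ b)
    rcases mul_eq_zero.1 h5 with h6 | h6
    · linarith
    · linarith
  obtain ⟨k, hk⟩ := hK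
  have hall : ∀ b, Relation.ReflTransGen (fun a b => 0 < Q a b) m b → z b = z m := by
    intro b hb
    induction hb with
    | refl => rfl
    | tail _ hbc ih => exact hstep _ _ ih hbc
  have := hall k (hirr m k)
  rw [hz k hk] at this
  linarith

lemma IsRateMatrix.exists_isMeanTime (hQ : IsRateMatrix Q) (hirr : IsIrreducibleRate Q) {K : Set S}
    (hK : K.Nonempty) : ∃ h, IsMeanTime Q K h := by
  -- The killed generator has zero rows on `K`. Replacing them by minus the identity encodes the
  -- boundary condition `h = 0` on `K` and makes the system square and injective, by the maximum
  -- principle applied to `g - g'` and to its opposite.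
  let D : Matrix S S ℝ := killed Q K - Matrix.diagonal (K.indicator fun _ => (1 : ℝ))
  have hDK : ∀ g : S → ℝ, ∀ x ∈ K, (D *ᵥ g) x = -g x := by
    intro g x hx
    simp [D, Matrix.sub_mulVec, killed_mulVec_of_mem Q g hx, Matrix.mulVec_diagonal, hx]
  have hDA : ∀ g : S → ℝ, ∀ x, x ∉ K → (D *ᵥ g) x = (killed Q K *ᵥ g) x := by
    intro g x hx
    simp [D, Matrix.sub_mulVec, Matrix.mulVec_diagonal, hx]
  have hnonpos : ∀ g : S → ℝ, D *ᵥ g = 0 → ∀ x, g x ≤ 0 := by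
    intro g hg
    refine hQ.harmonic_nonpos hirr hK (fun x hx => ?_) fun x hx => ?_
    · have := congrFun hg x
      rw [hDK g x hx] at this
      simpa using this
    · rw [← hDA g x hx, hg]; rfl
  have hinj : Function.Injective D.mulVec := by
    intro g g' hgg
    have h1 : D *ᵥ (g - g') = 0 := by
      rw [Matrix.mulVec_sub]; exact sub_eq_zero.2 hgg
    have h2 : D *ᵥ (g' - g) = 0 := by
      rw [Matrix.mulVec_sub]; exact sub_eq_zero.2 hgg.symm
    ext x
    have h3 := hnonpos _ h1 x
    have h4 := hnonpos _ h2 x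
    simp only [Pi.sub_apply] at h3 h4
    linarith
  obtain ⟨h, hh⟩ := Matrix.mulVec_surjective_iff_isUnit.2 (Matrix.mulVec_injective_iff_isUnit.1 hinj)
    (-Kᶜ.indicator fun _ => (1 : ℝ))
  refine ⟨h, fun x hx => ?_, fun x => ?_⟩
  · have := congrFun hh x
    change (D *ᵥ h) x = _ at this
    rw [hDK h x hx] at this
    simpa [hx] using this
  · by_cases hx : x ∈ K
    · simp [killed_mulVec_of_mem Q h hx, hx]
    · rw [← hDA h x hx]
      exact congrFun hh x

variable {K : Set S} {h : S → ℝ}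

/-- Dynkin's formula in differential form: `h - exp (t • killed Q K) *ᵥ h` is the mean of `min τ t`,
with `τ` the hitting time of `K`. The next two lemmas are `T P(τ > T) ≤ E[min τ T]` and `E[min τ T]
≤ T`. -/
lemma IsMeanTime.hasDerivAt (hh : IsMeanTime Q K h) (t : ℝ) (x : S) :
    HasDerivAt (fun t : ℝ => h x - (NormedSpace.exp (t • killed Q K) *ᵥ h) x)
      (survival Q K t x) t := by
  refine ((Matrix.hasDerivAt_exp_mulVec (killed Q K) h t x).const_sub (h x)).congr_deriv ?_
  have h1 : killed Q K *ᵥ h = -Kᶜ.indicator fun _ => (1 : ℝ) := funext hh.generator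
  rw [h1, Matrix.mulVec_neg, Pi.neg_apply, neg_neg]
  rfl

lemma IsMeanTime.mul_survival_le (hQ : IsRateMatrix Q) (hh : IsMeanTime Q K h) {T : ℝ} (hT : 0 ≤ T)
    (x : S) : T * survival Q K T x ≤ h x - (NormedSpace.exp (T • killed Q K) *ᵥ h) x := by
  have hd := fun t => (hh.hasDerivAt t x).sub ((hasDerivAt_id t).mul_const (survival Q K T x))
  have hmono : MonotoneOn (fun t : ℝ => (h x - (NormedSpace.exp (t • killed Q K) *ᵥ h) x) -
      t * survival Q K T x) (Set.Icc 0 T) := by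
    refine monotoneOn_of_deriv_nonneg (convex_Icc 0 T)
      (fun t _ => (hd t).continuousAt.continuousWithinAt)
      (fun t _ => (hd t).differentiableAt.differentiableWithinAt) fun t ht => ?_
    rw [interior_Icc] at ht
    refine le_of_le_of_eq ?_ (hd t).deriv.symm
    rw [one_mul]
    exact sub_nonneg.2 (hQ.survival_antitone K ht.1.le ht.2.le x)
  have := hmono (Set.left_mem_Icc.2 hT) (Set.right_mem_Icc.2 hT) hT
  simp only [Matrix.exp_zero_smul, Matrix.one_mulVec, sub_self, zero_mul] at this
  linarith

lemma IsMeanTime.sub_le (hQ : IsRateMatrix Q) (hh : IsMeanTime Q K h) {T : ℝ} (hT : 0 ≤ T)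
    (x : S) : h x - (NormedSpace.exp (T • killed Q K) *ᵥ h) x ≤ T := by
  have hd := fun t => (hasDerivAt_id t).sub (hh.hasDerivAt t x)
  have hmono : MonotoneOn (fun t : ℝ => t - (h x - (NormedSpace.exp (t • killed Q K) *ᵥ h) x))
      (Set.Icc 0 T) := by
    refine monotoneOn_of_deriv_nonneg (convex_Icc 0 T)
      (fun t _ => (hd t).continuousAt.continuousWithinAt)
      (fun t _ => (hd t).differentiableAt.differentiableWithinAt) fun t ht => ?_
    rw [interior_Icc] at ht
    refine le_of_le_of_eq ?_ (hd t).deriv.symm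
    exact sub_nonneg.2 (hQ.survival_le_one K ht.1.le x)
  have := hmono (Set.left_mem_Icc.2 hT) (Set.right_mem_Icc.2 hT) hT
  simp only [Matrix.exp_zero_smul, Matrix.one_mulVec, sub_self] at this
  linarith

lemma IsMeanTime.abs_exp_mulVec_le (hQ : IsRateMatrix Q) (hh : IsMeanTime Q K h) {C : ℝ}
    (hC : ∀ y, |h y| ≤ C) {t : ℝ} (ht : 0 ≤ t) (x : S) :
    |(NormedSpace.exp (t • killed Q K) *ᵥ h) x| ≤ C * survival Q K t x := by
  have hE := (hQ.isMetzler_killed K).exp_nonneg ht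
  have h1 : C * survival Q K t x =
      (NormedSpace.exp (t • killed Q K) *ᵥ (C • Kᶜ.indicator fun _ => (1 : ℝ))) x := by
    rw [Matrix.mulVec_smul]; rfl
  rw [h1]
  have h2 : ∀ y, |h y| ≤ (C • Kᶜ.indicator fun _ => (1 : ℝ)) y := by
    intro y
    by_cases hy : y ∈ K
    · simp [hh.eq_zero y hy, hy]
    · simpa [hy] using hC y
  refine abs_le.2 ⟨?_, Matrix.mulVec_mono hE (fun y => (le_abs_self _).trans (h2 y)) x⟩
  rw [← Pi.neg_apply, ← Matrix.mulVec_neg]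
  exact Matrix.mulVec_mono hE (fun y => (neg_le_neg (h2 y)).trans (neg_abs_le _)) x

lemma IsMeanTime.tendsto_exp_mulVec (hQ : IsRateMatrix Q) (hh : IsMeanTime Q K h) (x : S) :
    Tendsto (fun t : ℝ => (NormedSpace.exp (t • killed Q K) *ᵥ h) x) atTop (𝓝 0) := by
  obtain ⟨C, hC⟩ : ∃ C, ∀ y, |h y| ≤ C := by
    refine ⟨∑ z, |h z|, fun y => ?_⟩
    exact Finset.single_le_sum (f := fun z => |h z|) (fun z _ => abs_nonneg _) (Finset.mem_univ y)
  have hC0 : 0 ≤ C := (abs_nonneg _).trans (hC x)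
  -- With `|h| ≤ C`, the bound `t P(τ > t) ≤ E[min τ t] ≤ 2 C` gives survival at most `2 C / t`, and
  -- the semigroup applied to `h` is at most `C` times survival.
  refine squeeze_zero_norm' (a := fun t : ℝ => C * (2 * C / t)) ?_ ?_
  · filter_upwards [eventually_gt_atTop 0] with t ht
    rw [Real.norm_eq_abs]
    refine (hh.abs_exp_mulVec_le hQ hC ht.le x).trans (mul_le_mul_of_nonneg_left ?_ hC0)
    rw [le_div_iff₀ ht, mul_comm]
    have h1 := hh.mul_survival_le hQ ht.le x
    have h2 := hh.abs_exp_mulVec_le hQ hC ht.le x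
    have h3 := mul_le_mul_of_nonneg_left (hQ.survival_le_one K ht.le x) hC0
    have h4 := neg_abs_le ((NormedSpace.exp (t • killed Q K) *ᵥ h) x)
    have h5 := le_abs_self (h x)
    have h6 := hC x
    linarith
  · have := (tendsto_const_nhds (x := 2 * C)).div_atTop (tendsto_id (α := ℝ))
    simpa using this.const_mul C

lemma IsMeanTime.nonneg (hQ : IsRateMatrix Q) (hh : IsMeanTime Q K h) (x : S) : 0 ≤ h x := by
  refine le_of_tendsto (hh.tendsto_exp_mulVec hQ x) ?_
  filter_upwards [eventually_ge_atTop 0] with t ht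
  have h1 := hh.mul_survival_le hQ ht x
  have h2 := mul_nonneg ht (hQ.survival_nonneg K ht x)
  linarith

/-- The mean hitting time is the integral of the survival probabilities. -/
lemma IsMeanTime.lintegral_survival (hQ : IsRateMatrix Q) (hh : IsMeanTime Q K h) (x : S) :
    ∫⁻ t in Set.Ioi (0 : ℝ), ENNReal.ofReal (survival Q K t x) = ENNReal.ofReal (h x) := by
  have hc := (hh.hasDerivAt 0 x).continuousAt.continuousWithinAt (s := Set.Ici 0)
  have hl := (tendsto_const_nhds (x := h x)).sub (hh.tendsto_exp_mulVec hQ x)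
  have hnn : ∀ t ∈ Set.Ioi (0 : ℝ), 0 ≤ survival Q K t x :=
    fun t ht => hQ.survival_nonneg K (le_of_lt ht) x
  have hint := integrableOn_Ioi_deriv_of_nonneg hc (fun t _ => hh.hasDerivAt t x) hnn hl
  have hval := integral_Ioi_of_hasDerivAt_of_nonneg hc (fun t _ => hh.hasDerivAt t x) hnn hl
  rw [← ofReal_integral_eq_lintegral_ofReal hint
    ((ae_restrict_iff' measurableSet_Ioi).2 (Eventually.of_forall hnn)), hval]
  simp

end Killed

/-! ### Comparison estimates for a chain that quickly reaches `B ∪ K`. -/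

section Recurrence

open Matrix
open scoped Matrix.Norms.Operator

variable {S : Type*} [Fintype S] [DecidableEq S] {Q : Matrix S S ℝ} {K : Set S} {h : S → ℝ}

/-- A non-negative superharmonic function which is at least `m` on `B` is at least `m` times the
probability of reaching `B` before `K` and before time `s`. -/
lemma IsRateMatrix.superharmonic_ge (hQ : IsRateMatrix Q) (B : Set S) {u : S → ℝ} {m s : ℝ}
    (hm : 0 ≤ m) (hs : 0 ≤ s) (hu : ∀ x, 0 ≤ u x) (hLu : ∀ x, (killed Q K *ᵥ u) x ≤ 0)
    (huB : ∀ x ∈ B, x ∉ K → m ≤ u x) (x : S) :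
    m * (survival Q K s x - survival Q (B ∪ K) s x) ≤ u x := by
  by_cases hxK : x ∈ K
  · rw [survival_of_mem Q hxK, survival_of_mem Q (Or.inr hxK)]
    simpa using hu x
  by_cases hxB : x ∈ B
  · rw [survival_of_mem Q (K := B ∪ K) (Or.inl hxB), sub_zero]
    exact (mul_le_of_le_one_right hm (hQ.survival_le_one K hs x)).trans (huB x hxB hxK)
  have hxC : x ∉ B ∪ K := by simp [hxB, hxK]
  -- The difference of survivals is the probability that `B` is reached by time `s` while `K` is
  -- not. The gap between the two sides of the inequality, set to zero on `B ∪ K`, is a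
  -- supersolution for the generator killed on `B ∪ K`, so the comparison principle applies.
  have hd : ∀ t x, HasDerivAt (fun t => (B ∪ K)ᶜ.indicator
      (fun x => u x - m * (survival Q K t x - survival Q (B ∪ K) t x)) x)
      ((B ∪ K)ᶜ.indicator (fun x => -(m * ((killed Q K *ᵥ survival Q K t) x -
        (killed Q (B ∪ K) *ᵥ survival Q (B ∪ K) t) x))) x) t := by
    intro t x
    by_cases hx : x ∈ (B ∪ K)ᶜ
    · simp only [Set.indicator_of_mem hx]
      exact (((hasDerivAt_survival Q K t x).sub
        (hasDerivAt_survival Q (B ∪ K) t x)).const_mul m).const_sub (u x)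
    · simp only [Set.indicator_of_notMem hx]
      exact hasDerivAt_const t 0
  have key := (hQ.isMetzler_killed (B ∪ K)).comparison hs hd ?_ ?_ x
  · rw [Set.indicator_of_mem (by exact hxC)] at key
    linarith
  · intro t ht x
    by_cases hx : x ∈ B ∪ K
    · rw [killed_mulVec_of_mem Q _ hx, Set.indicator_of_notMem (by exact not_not.2 hx)]
    · have hxK : x ∉ K := fun h => hx (Or.inr h)
      rw [Set.indicator_of_mem (by exact hx), killed_mulVec_of_notMem Q _ hx,
        killed_mulVec_of_notMem Q _ hx, killed_mulVec_of_notMem Q _ hxK]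
      have h1 := hLu x
      rw [killed_mulVec_of_notMem Q _ hxK] at h1
      rw [← sub_nonneg]
      refine le_trans (neg_nonneg.2 h1) (le_of_sub_nonneg ?_)
      rw [← Finset.sum_sub_distrib, Finset.mul_sum, ← Finset.sum_neg_distrib,
        ← Finset.sum_neg_distrib, ← Finset.sum_sub_distrib, ← Finset.sum_sub_distrib]
      -- Jumps into `K` contribute nothing, jumps into `B` contribute a rate times `u y - m *
      -- survival ≥ 0`, and the other terms cancel.
      refine Finset.sum_nonneg fun y _ => ?_
      by_cases hyK : y ∈ K
      · simp [hyK]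
      by_cases hyB : y ∈ B
      · have hxy : x ≠ y := by rintro rfl; exact hx (Or.inl hyB)
        have h2 := huB y hyB hyK
        have h3 := mul_le_of_le_one_right hm (hQ.survival_le_one K ht y)
        have h4 := mul_nonneg (hQ.nonneg x y hxy) (sub_nonneg.2 (h3.trans h2))
        simp only [Set.mem_compl_iff, Set.mem_union, hyK, hyB, or_false, not_true_eq_false,
          not_false_eq_true, Set.indicator_of_mem, Set.indicator_of_notMem, mul_zero, sub_zero]
        linarith
      · have hy : y ∈ (B ∪ K)ᶜ := by simp [hyK, hyB]
        have hy' : y ∈ Kᶜ := hyK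
        simp only [Set.indicator_of_mem hy, Set.indicator_of_mem hy']
        apply le_of_eq
        ring
  · intro x
    by_cases hx : x ∈ B ∪ K
    · rw [Set.indicator_of_notMem (by exact not_not.2 hx)]
    · have hxK : x ∉ K := fun h => hx (Or.inr h)
      rw [Set.indicator_of_mem (by exact hx), survival_zero, survival_zero,
        Set.indicator_of_mem (by exact hxK), Set.indicator_of_mem (by exact hx)]
      simpa using hu x

/-- The mean hitting time of `K` exceeds its maximum over `B` only by the time needed to reach
`B ∪ K`. -/
lemma IsMeanTime.le_of_recurrence (hQ : IsRateMatrix Q) (hh : IsMeanTime Q K h) (B : Set S)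
    {m H R r : ℝ} (hR : 0 ≤ R) (hm : 0 ≤ m) (hmH : m ≤ H) (hB : ∀ x ∈ B, h x ≤ m)
    (hH : ∀ x, h x ≤ H) {x : S} (hr : survival Q (B ∪ K) R x ≤ r) (hr0 : 0 ≤ r) :
    h x ≤ m + R + r * (H - m) := by
  have hpos : 0 ≤ R + r * (H - m) := add_nonneg hR (mul_nonneg hr0 (sub_nonneg.2 hmH))
  by_cases hxK : x ∈ K
  · rw [hh.eq_zero x hxK]; linarith
  by_cases hxB : x ∈ B
  · linarith [hB x hxB]
  have hxC : x ∈ (B ∪ K)ᶜ := by simp [hxB, hxK]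
  -- The function `g` satisfies `L g ≥ -1` for the generator `L` killed on `B ∪ K`. Hence `exp (t L)
  -- g + t` increases, and comparing times `0` and `R` bounds `h x - m` by `R` plus `H - m` times
  -- the probability of avoiding `B ∪ K`.
  set g : S → ℝ := (B ∪ K)ᶜ.indicator fun y => h y - m with hg
  have hLg : ∀ y, -(B ∪ K)ᶜ.indicator (fun _ => (1 : ℝ)) y ≤ (killed Q (B ∪ K) *ᵥ g) y := by
    intro y
    by_cases hy : y ∈ B ∪ K
    · rw [killed_mulVec_of_mem Q _ hy, Set.indicator_of_notMem (by exact not_not.2 hy), neg_zero]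
    have hyK : y ∉ K := fun h => hy (Or.inr h)
    have h1 := hh.generator y
    rw [Set.indicator_of_mem (by exact hyK), killed_mulVec_of_notMem Q _ hyK] at h1
    rw [Set.indicator_of_mem (by exact hy), ← h1, killed_mulVec_of_notMem Q _ hy, ← sub_nonneg,
      ← Finset.sum_sub_distrib]
    -- Row sums vanish, so the constant `m` can be subtracted everywhere. What remains are jumps
    -- into `K`, worth `Q y z * m`, and into `B`, worth `Q y z * (m - h z)`, all non-negative.
    have h2 : (0 : ℝ) = -∑ z, Q y z * m := by rw [← Finset.sum_mul, hQ.row_sum]; simp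
    rw [h2, ← Finset.sum_neg_distrib]
    rw [← sub_nonneg, ← Finset.sum_sub_distrib]
    refine Finset.sum_nonneg fun z _ => ?_
    by_cases hzK : z ∈ K
    · have hyz : y ≠ z := by rintro rfl; exact hyK hzK
      have := mul_nonneg (hQ.nonneg y z hyz) hm
      simpa [hzK] using this
    by_cases hzB : z ∈ B
    · have hyz : y ≠ z := by rintro rfl; exact hy (Or.inl hzB)
      have := mul_nonneg (hQ.nonneg y z hyz) (sub_nonneg.2 (hB z hzB))
      simp only [Set.mem_compl_iff, Set.mem_union, hzK, hzB, or_false, not_true_eq_false,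
          not_false_eq_true, Set.indicator_of_mem, Set.indicator_of_notMem, mul_zero, zero_sub]
      linarith
    · have hz : z ∈ (B ∪ K)ᶜ := by simp [hzK, hzB]
      have hz' : z ∈ Kᶜ := hzK
      simp only [hg, Set.indicator_of_mem hz, Set.indicator_of_mem hz']
      apply le_of_eq
      ring
  have hE := fun {t : ℝ} (ht : 0 ≤ t) => (hQ.isMetzler_killed (B ∪ K)).exp_nonneg ht
  have hd := fun t => (Matrix.hasDerivAt_exp_mulVec (killed Q (B ∪ K)) g t x).add (hasDerivAt_id t)
  have hmono : MonotoneOn (fun t : ℝ => (NormedSpace.exp (t • killed Q (B ∪ K)) *ᵥ g) x + t)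
      (Set.Icc 0 R) := by
    refine monotoneOn_of_deriv_nonneg (convex_Icc 0 R)
      (fun t _ => (hd t).continuousAt.continuousWithinAt)
      (fun t _ => (hd t).differentiableAt.differentiableWithinAt) fun t ht => ?_
    rw [interior_Icc] at ht
    refine le_of_le_of_eq ?_ (hd t).deriv.symm
    have h1 := Matrix.mulVec_mono (hE ht.1.le) hLg x
    have h2 := hQ.survival_le_one (B ∪ K) ht.1.le x
    have h3 : (NormedSpace.exp (t • killed Q (B ∪ K)) *ᵥ
        fun y => -(B ∪ K)ᶜ.indicator (fun _ => (1 : ℝ)) y) x = -survival Q (B ∪ K) t x := by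
      rw [survival, ← Pi.neg_apply, ← Matrix.mulVec_neg]; rfl
    rw [h3] at h1
    linarith
  have h1 := hmono (Set.left_mem_Icc.2 hR) (Set.right_mem_Icc.2 hR) hR
  simp only [Matrix.exp_zero_smul, Matrix.one_mulVec, add_zero] at h1
  have h2 : (NormedSpace.exp (R • killed Q (B ∪ K)) *ᵥ g) x ≤
      (NormedSpace.exp (R • killed Q (B ∪ K)) *ᵥ
        ((H - m) • (B ∪ K)ᶜ.indicator fun _ => (1 : ℝ))) x := by
    refine Matrix.mulVec_mono (hE hR) (fun y => ?_) x
    by_cases hy : y ∈ (B ∪ K)ᶜ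
    · simp only [hg, Set.indicator_of_mem hy, Pi.smul_apply, smul_eq_mul, mul_one]
      linarith [hH y]
    · simp only [hg, Set.indicator_of_notMem hy, Pi.smul_apply, smul_zero, le_refl]
  rw [Matrix.mulVec_smul] at h2
  have h3 : ((H - m) • (NormedSpace.exp (R • killed Q (B ∪ K)) *ᵥ
      (B ∪ K)ᶜ.indicator fun _ => (1 : ℝ))) x = (H - m) * survival Q (B ∪ K) R x := rfl
  rw [h3] at h2
  have h4 := mul_le_mul_of_nonneg_left hr (sub_nonneg.2 hmH)
  have h5 : g x = h x - m := by simp only [hg, Set.indicator_of_mem hxC]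
  linarith

end Recurrence

/-! ### Trigonometric sums and dominant exponents. -/

section ExponentialSums

lemma tendsto_average_pow {z : ℂ} (hz : ‖z‖ = 1) (hz1 : z ≠ 1) :
    Tendsto (fun N : ℕ => (N : ℂ)⁻¹ * ∑ n ∈ Finset.range N, z ^ n) atTop (𝓝 0) := by
  refine squeeze_zero_norm (a := fun N : ℕ => (N : ℝ)⁻¹ * (2 / ‖z - 1‖)) (fun N => ?_) ?_
  · rw [norm_mul, norm_inv, Complex.norm_natCast, geom_sum_eq hz1, norm_div]
    gcongr
    refine (norm_sub_le _ _).trans ?_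
    rw [norm_pow, hz]
    norm_num
  · simpa using (tendsto_inv_atTop_nhds_zero_nat (𝕜 := ℝ)).mul_const (2 / ‖z - 1‖)

lemma tendsto_average_pow_ite {z : ℂ} (hz : ‖z‖ = 1) :
    Tendsto (fun N : ℕ => (N : ℂ)⁻¹ * ∑ n ∈ Finset.range N, z ^ n) atTop
      (𝓝 (if z = 1 then 1 else 0)) := by
  split_ifs with h
  · subst h
    refine tendsto_const_nhds.congr' ?_
    filter_upwards [eventually_ne_atTop 0] with N hN
    have : (N : ℂ) ≠ 0 := by exact_mod_cast hN
    simp [this]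
  · exact tendsto_average_pow hz h

lemma tendsto_average_mul_zero {c ε : ℕ → ℂ} (hc : ∀ n, ‖c n‖ ≤ 1)
    (hε : Tendsto ε atTop (𝓝 0)) :
    Tendsto (fun N : ℕ => (N : ℂ)⁻¹ * ∑ n ∈ Finset.range N, c n * ε n) atTop (𝓝 0) := by
  have h1 := (tendsto_zero_iff_norm_tendsto_zero.1 hε).cesaro
  refine squeeze_zero_norm (fun N => ?_) h1
  rw [norm_mul, norm_inv, Complex.norm_natCast]
  gcongr
  refine (norm_sum_le _ _).trans (Finset.sum_le_sum fun n _ => ?_)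
  rw [norm_mul]
  exact mul_le_of_le_one_left (norm_nonneg _) (hc n)

/-- Sampling at multiples of `δ` must not identify distinct frequencies. It suffices that every `(l
- m) * δ` has norm below `1`, which excludes the non-zero multiples of `2πi`. -/
lemma exists_step_separating (Λ : Finset ℂ) :
    ∃ δ : ℝ, 0 < δ ∧ ∀ l ∈ Λ, ∀ m ∈ Λ, Complex.exp ((l - m) * δ) = 1 → l = m := by
  have hM : ∀ l ∈ Λ, ‖l‖ ≤ ∑ k ∈ Λ, ‖k‖ := fun l hl =>
    Finset.single_le_sum (f := fun k : ℂ => ‖k‖) (fun k _ => norm_nonneg k) hl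
  set M := ∑ k ∈ Λ, ‖k‖ with hMdef
  have hM0 : 0 ≤ M := Finset.sum_nonneg fun _ _ => norm_nonneg _
  refine ⟨(1 + 2 * M)⁻¹, by positivity, fun l hl m hm h => ?_⟩
  obtain ⟨n, hn⟩ := Complex.exp_eq_one_iff.1 h
  have h1 : ‖(l - m) * ((1 + 2 * M)⁻¹ : ℝ)‖ < 1 := by
    rw [norm_mul, Complex.norm_real, Real.norm_of_nonneg (by positivity), ← div_eq_mul_inv,
      div_lt_one (by positivity)]
    linarith [norm_sub_le l m, hM l hl, hM m hm]
  have h2 : n = 0 := by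
    by_contra hn0
    have h3 : (1 : ℝ) ≤ |(n : ℝ)| := by exact_mod_cast Int.one_le_abs hn0
    rw [hn] at h1
    have h4 : ‖(n : ℂ) * (2 * Real.pi * Complex.I)‖ = |(n : ℝ)| * (2 * Real.pi) := by
      rw [norm_mul, norm_mul, norm_mul, Complex.norm_I, Complex.norm_intCast, Complex.norm_real,
        Real.norm_of_nonneg Real.pi_pos.le]
      simp
    rw [h4] at h1
    nlinarith [Real.pi_gt_three]
  rw [h2, Int.cast_zero, zero_mul, mul_eq_zero] at hn
  rcases hn with hn | hn
  · exact sub_eq_zero.1 hn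
  · exfalso
    have : (1 + 2 * M)⁻¹ = 0 := by exact_mod_cast hn
    have h5 : 0 < (1 + 2 * M)⁻¹ := by positivity
    linarith

/-- If a non-negative function is asymptotic to a trigonometric sum, its constant coefficient
dominates all the others. -/
lemma norm_coeff_le_of_nonneg (Λ : Finset ℂ) {s : ℝ} (hre : ∀ l ∈ Λ, l.re = s)
    (hs : (s : ℂ) ∈ Λ) (e : ℂ → ℂ) {b : ℝ → ℝ} (hb : ∀ t, 0 ≤ t → 0 ≤ b t)
    (hlim : Tendsto (fun t : ℝ => (b t : ℂ) - ∑ l ∈ Λ, Complex.exp ((l - s) * t) * e l) atTop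
      (𝓝 0)) {m : ℂ} (hm : m ∈ Λ) : ‖e m‖ ≤ (e s).re := by
  obtain ⟨δ, hδ, hsep⟩ := exists_step_separating Λ
  have hnorm : ∀ l ∈ Λ, ∀ k ∈ Λ, ‖Complex.exp ((l - k) * δ)‖ = 1 := by
    intro l hl k hk
    rw [Complex.norm_exp]
    simp [hre l hl, hre k hk]
  set ε : ℕ → ℂ := fun n => (b (n * δ) : ℂ) -
    ∑ l ∈ Λ, Complex.exp ((l - s) * ((n * δ : ℝ) : ℂ)) * e l with hε
  have hε0 : Tendsto ε atTop (𝓝 0) :=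
    hlim.comp (tendsto_natCast_atTop_atTop.atTop_mul_const hδ)
  -- The Cesàro mean of the samples of `b` against the character of frequency `k` extracts the
  -- coefficient `e k`: the other frequencies average to zero, and so does the error `ε`.
  have hmean : ∀ k ∈ Λ, Tendsto (fun N : ℕ => (N : ℂ)⁻¹ *
      ∑ n ∈ Finset.range N, Complex.exp ((s - k) * δ) ^ n * (b (n * δ) : ℂ)) atTop (𝓝 (e k)) := by
    intro k hk
    have h1 : Tendsto (fun N : ℕ => ∑ l ∈ Λ, ((N : ℂ)⁻¹ *
        ∑ n ∈ Finset.range N, Complex.exp ((l - k) * δ) ^ n) * e l) atTop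
        (𝓝 (∑ l ∈ Λ, (if Complex.exp ((l - k) * δ) = 1 then 1 else 0) * e l)) :=
      tendsto_finsetSum _ fun l hl => (tendsto_average_pow_ite (hnorm l hl k hk)).mul_const _
    have h2 : ∑ l ∈ Λ, (if Complex.exp ((l - k) * δ) = 1 then 1 else 0) * e l = e k := by
      rw [Finset.sum_eq_single k]
      · simp
      · intro l hl hlk
        rw [if_neg fun h => hlk (hsep l hl k hk h), zero_mul]
      · exact fun h => absurd hk h
    rw [h2] at h1
    have h3 := tendsto_average_mul_zero (c := fun n => Complex.exp ((s - k) * δ) ^ n)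
      (fun n => by rw [norm_pow, hnorm s hs k hk, one_pow]) hε0
    have h4 := h1.add h3
    rw [add_zero] at h4
    refine h4.congr fun N => ?_
    simp only [mul_assoc, ← Finset.mul_sum, Finset.sum_mul]
    rw [Finset.sum_comm, ← mul_add, ← Finset.sum_add_distrib]
    congr 1
    refine Finset.sum_congr rfl fun n _ => ?_
    simp only [hε, mul_sub, Finset.mul_sum]
    rw [add_sub_left_comm, add_eq_left, sub_eq_zero]
    refine Finset.sum_congr rfl fun l _ => ?_
    rw [← mul_assoc, ← Complex.exp_nat_mul, ← Complex.exp_nat_mul, ← Complex.exp_add]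
    congr 2
    push_cast
    ring
  -- The characters have modulus one and `b ≥ 0`, so the mean against any character is at most the
  -- plain mean in modulus, and the plain mean tends to `e s`.
  have hle : ∀ N : ℕ, ‖(N : ℂ)⁻¹ *
      ∑ n ∈ Finset.range N, Complex.exp ((s - m) * δ) ^ n * (b (n * δ) : ℂ)‖ ≤
      ((N : ℂ)⁻¹ * ∑ n ∈ Finset.range N, Complex.exp ((s - s) * δ) ^ n * (b (n * δ) : ℂ)).re := by
    intro N
    have h1 : (N : ℂ)⁻¹ * ∑ n ∈ Finset.range N, Complex.exp ((s - s) * δ) ^ n * (b (n * δ) : ℂ) =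
        (((N : ℝ)⁻¹ * ∑ n ∈ Finset.range N, b (n * δ) : ℝ) : ℂ) := by
      push_cast
      simp
    rw [h1, Complex.ofReal_re, norm_mul, norm_inv, Complex.norm_natCast]
    gcongr
    refine (norm_sum_le _ _).trans (Finset.sum_le_sum fun n _ => ?_)
    rw [norm_mul, norm_pow, hnorm s hs m hm, one_pow, one_mul, Complex.norm_real,
      Real.norm_of_nonneg (hb _ (by positivity))]
  exact le_of_tendsto_of_tendsto' (hmean m hm).norm
    ((Complex.continuous_re.tendsto _).comp (hmean s hs)) hle

lemma tendsto_pow_mul_exp_div {l : ℂ} {s : ℝ} {k k₀ : ℕ} (h : l.re < s ∨ l.re = s ∧ k < k₀) :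
    Tendsto (fun t : ℝ => (t : ℂ) ^ k * Complex.exp (l * t) / ((t ^ k₀ * Real.exp (s * t) : ℝ) : ℂ))
      atTop (𝓝 0) := by
  rw [tendsto_zero_iff_norm_tendsto_zero]
  have heq : ∀ᶠ t : ℝ in atTop, t ^ k / t ^ k₀ * Real.exp (-((s - l.re) * t)) =
      ‖(t : ℂ) ^ k * Complex.exp (l * t) / ((t ^ k₀ * Real.exp (s * t) : ℝ) : ℂ)‖ := by
    filter_upwards [eventually_gt_atTop 0] with t ht
    rw [norm_div, norm_mul, norm_pow, Complex.norm_real, Complex.norm_real, Complex.norm_exp,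
      Real.norm_of_nonneg ht.le, Real.norm_of_nonneg (by positivity), Complex.re_mul_ofReal,
      mul_div_mul_comm, ← Real.exp_sub]
    congr 2
    ring
  refine Tendsto.congr' heq ?_
  rcases h with h | ⟨h, hk⟩
  · have h1 : Tendsto (fun t : ℝ => t ^ k * Real.exp (-((s - l.re) * t))) atTop (𝓝 0) := by
      have := (isLittleO_pow_exp_pos_mul_atTop k (sub_pos.2 h)).tendsto_div_nhds_zero
      refine this.congr fun t => ?_
      rw [Real.exp_neg, div_eq_mul_inv]
    refine squeeze_zero' ?_ ?_ h1
    · filter_upwards [eventually_ge_atTop 0] with t ht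
      positivity
    · filter_upwards [eventually_ge_atTop 1] with t ht
      refine mul_le_mul_of_nonneg_right ?_ (Real.exp_pos _).le
      exact div_le_self (by positivity) (one_le_pow₀ ht)
  · simp only [h, sub_self, zero_mul, neg_zero, Real.exp_zero, mul_one]
    exact tendsto_pow_div_pow_atTop_zero hk

end ExponentialSums

/-! ### Convergence of the normalized rows of the semigroup. -/

section QuasiLimit

open Matrix
open scoped Matrix.Norms.Operator

/-- A vector is a finite sum of polynomial chains of generalized eigenvectors. -/
lemma Module.End.exists_eigenchains {V : Type*} [AddCommGroup V] [Module ℂ V]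
    [FiniteDimensional ℂ V] (T : Module.End ℂ V) (v : V) :
    ∃ (Λ : Finset ℂ) (n : ℕ) (c : ℂ → ℕ → V), (∀ l, l ∉ Λ → ∀ k, c l k = 0) ∧
      (∀ l k, n ≤ k → c l k = 0) ∧ ∑ l ∈ Λ, c l 0 = v ∧
      ∀ l k, T (c l k) = l • c l k + ((k + 1 : ℕ) : ℂ) • c l (k + 1) := by
  have hv : v ∈ ⨆ μ, T.maxGenEigenspace μ := by
    rw [Module.End.iSup_maxGenEigenspace_eq_top]; trivial
  obtain ⟨w, hw, hsum⟩ := (Submodule.mem_iSup_iff_exists_finsupp _ _).1 hv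
  have hN : ∀ l, ∃ k, ((T - l • (1 : Module.End ℂ V)) ^ k) (w l) = 0 := fun l =>
    (Module.End.mem_maxGenEigenspace T l _).1 (hw l)
  choose N hN using hN
  -- With `w l` the component of `v` in the generalized eigenspace of `l`, the vector `(T - l)^k (w
  -- l) / k!` is the coefficient of `t^k exp (l t)` in `exp (t T) v`.
  refine ⟨w.support, ∑ l ∈ w.support, N l,
    fun l k => ((k.factorial : ℂ)⁻¹) • ((T - l • (1 : Module.End ℂ V)) ^ k) (w l), ?_, ?_, ?_, ?_⟩
  · intro l hl k
    beta_reduce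
    rw [Finsupp.notMem_support_iff.1 hl, map_zero, smul_zero]
  · intro l k hk
    beta_reduce
    by_cases hl : l ∈ w.support
    · rw [Module.End.pow_map_zero_of_le
        ((Finset.single_le_sum (fun _ _ => Nat.zero_le _) hl).trans hk) (hN l), smul_zero]
    · rw [Finsupp.notMem_support_iff.1 hl, map_zero, smul_zero]
  · simpa [Finsupp.sum] using hsum
  · intro l k
    have h1 : T = (T - l • (1 : Module.End ℂ V)) + l • (1 : Module.End ℂ V) := by abel
    have h2 : ∀ u, T u = (T - l • (1 : Module.End ℂ V)) u + l • u := by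
      intro u
      conv_lhs => rw [h1]
      simp
    beta_reduce
    rw [h2, map_smul, ← Module.End.mul_apply, ← pow_succ', smul_smul, add_comm, Nat.factorial_succ]
    congr 1
    rw [smul_smul]
    congr 1
    have h3 : ((k + 1 : ℕ) : ℂ) ≠ 0 := by exact_mod_cast Nat.succ_ne_zero k
    push_cast at h3 ⊢
    rw [mul_inv, ← mul_assoc, mul_inv_cancel₀ h3, one_mul]

variable {S : Type*} [Fintype S]

/-- A complex left eigenvector dominated by a real one of the same growth rate has a real
eigenvalue. -/
lemma IsMetzler.eigenvalue_eq_of_dominated {L : Matrix S S ℝ} (hL : IsMetzler L) {d : S → ℂ}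
    {p : S → ℝ} {l : ℂ} {s : ℝ} (hre : l.re = s) (hd : ∀ y, ∑ z, d z * (L z y : ℂ) = l * d y)
    (hp : ∀ y, ∑ z, p z * L z y = s * p y) (hdp : ∀ y, ‖d y‖ ≤ p y) (hne : d ≠ 0) :
    l = s := by
  classical
  obtain ⟨y₀, hy₀⟩ := Function.ne_iff.1 hne
  have hne' : Nonempty S := ⟨y₀⟩
  -- At a site where `‖d‖ / p` is largest, the triangle inequality in the eigenvalue equation gives
  -- `‖l - L y y‖ ≤ s - L y y`. The right side is the real part of `l - L y y`, so the imaginary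
  -- part is zero. Where `p` vanishes so does `d`, and the quotient is `0` by convention.
  obtain ⟨y, hy⟩ := Finite.exists_max fun z => ‖d z‖ / p z
  have hp0 : ∀ z, 0 ≤ p z := fun z => (norm_nonneg _).trans (hdp z)
  set m := ‖d y‖ / p y with hm
  have hm0 : 0 < m := by
    refine lt_of_lt_of_le ?_ (hy y₀)
    have h1 : 0 < ‖d y₀‖ := norm_pos_iff.2 hy₀
    exact div_pos h1 (h1.trans_le (hdp y₀))
  have hpy : 0 < p y := by
    rcases (hp0 y).eq_or_lt with h | h
    · rw [hm, ← h, div_zero] at hm0; exact absurd hm0 (lt_irrefl _)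
    · exact h
  have hdy : ‖d y‖ = m * p y := by rw [hm]; field_simp
  have hle : ∀ z, ‖d z‖ ≤ m * p z := by
    intro z
    rcases (hp0 z).eq_or_lt with h | h
    · have := hdp z
      rw [← h] at this ⊢
      simpa using this
    · rw [← div_le_iff₀ h]; exact hy z
  have h1 : (l - L y y) * d y = ∑ z ∈ Finset.univ.erase y, d z * (L z y : ℂ) := by
    rw [sub_mul, ← hd y, ← Finset.add_sum_erase _ _ (Finset.mem_univ y)]
    ring
  have h2 : (s - L y y) * p y = ∑ z ∈ Finset.univ.erase y, p z * L z y := by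
    rw [sub_mul, ← hp y, ← Finset.add_sum_erase _ _ (Finset.mem_univ y)]
    ring
  have h3 : ‖l - L y y‖ * (m * p y) ≤ (s - L y y) * (m * p y) := by
    rw [← hdy, ← norm_mul, h1, hdy, mul_left_comm, h2, Finset.mul_sum]
    refine (norm_sum_le _ _).trans (Finset.sum_le_sum fun z hz => ?_)
    have hzy := hL z y (Finset.ne_of_mem_erase hz)
    rw [norm_mul, Complex.norm_real, Real.norm_of_nonneg hzy, ← mul_assoc]
    exact mul_le_mul_of_nonneg_right (hle z) hzy
  have h4 : ‖l - L y y‖ ≤ s - L y y := le_of_mul_le_mul_right h3 (mul_pos hm0 hpy)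
  have h5 : (l - L y y).re = s - L y y := by simp [hre]
  have h6 : |(l - L y y).re| = ‖l - L y y‖ := by
    refine le_antisymm (Complex.abs_re_le_norm _) (h4.trans ?_)
    rw [← h5]; exact le_abs_self _
  have h7 := Complex.abs_re_eq_norm.1 h6
  refine Complex.ext (by simpa using hre) ?_
  simpa using h7

variable [DecidableEq S]

/-- Each row of the matrix exponential is an exponential polynomial. -/
lemma Matrix.exists_exp_apply_eq_sum (L : Matrix S S ℝ) (x : S) :
    ∃ (Λ : Finset ℂ) (n : ℕ) (c : ℂ → ℕ → S → ℂ), (∀ l, l ∉ Λ → ∀ k, c l k = 0) ∧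
      (∀ l k, n ≤ k → c l k = 0) ∧
      (∀ (t : ℝ) y, (NormedSpace.exp (t • L) x y : ℂ) =
        ∑ l ∈ Λ, ∑ k ∈ Finset.range n, (t : ℂ) ^ k * Complex.exp (l * t) * c l k y) ∧
      ∀ l k y, ∑ z, c l k z * (L z y : ℂ) = l * c l k y + ((k + 1 : ℕ) : ℂ) * c l (k + 1) y := by
  obtain ⟨Λ, n, c, hΛ, hn, hsum, hT⟩ :=
    Module.End.exists_eigenchains (Matrix.vecMulLinear (L.map ((↑) : ℝ → ℂ)))
      (Pi.single x 1 : S → ℂ)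
  have hT' : ∀ l k y, ∑ z, c l k z * (L z y : ℂ) =
      l * c l k y + ((k + 1 : ℕ) : ℂ) * c l (k + 1) y := by
    intro l k y
    simpa [Matrix.vecMul, dotProduct] using congrFun (hT l k) y
  refine ⟨Λ, n, c, hΛ, hn, ?_, hT'⟩
  set U : ℝ → S → ℂ := fun t y =>
    ∑ l ∈ Λ, ∑ k ∈ Finset.range n, (t : ℂ) ^ k * Complex.exp (l * t) * c l k y with hU
  have hdU : ∀ t y, HasDerivAt (fun t => U t y) (∑ z, U t z * (L z y : ℂ)) t := by
    intro t y
    have h1 : HasDerivAt (fun t => U t y) (∑ l ∈ Λ, ∑ k ∈ Finset.range n,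
        ((k : ℂ) * (t : ℂ) ^ (k - 1) * Complex.exp (l * t) +
          (t : ℂ) ^ k * (Complex.exp (l * t) * l)) * c l k y) t := by
      refine HasDerivAt.fun_sum fun l _ => HasDerivAt.fun_sum fun k _ => ?_
      have h2 : HasDerivAt (fun z : ℂ => z ^ k * Complex.exp (l * z) * c l k y)
        (((k : ℂ) * (t : ℂ) ^ (k - 1) * Complex.exp (l * t) +
          (t : ℂ) ^ k * (Complex.exp (l * t) * l)) * c l k y) (t : ℂ) := by
        have h3 := ((hasDerivAt_id (t : ℂ)).const_mul l).cexp
        simp only [id, mul_one] at h3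
        exact ((hasDerivAt_pow k (t : ℂ)).mul h3).mul_const _
      exact h2.comp_ofReal
    refine h1.congr_deriv ?_
    have h4 : ∑ z, U t z * (L z y : ℂ) = ∑ l ∈ Λ, ∑ k ∈ Finset.range n,
        (t : ℂ) ^ k * Complex.exp (l * t) *
          (l * c l k y + ((k + 1 : ℕ) : ℂ) * c l (k + 1) y) := by
      simp only [hU, Finset.sum_mul]
      rw [Finset.sum_comm]
      refine Finset.sum_congr rfl fun l _ => ?_
      rw [Finset.sum_comm]
      refine Finset.sum_congr rfl fun k _ => ?_
      rw [← hT', Finset.mul_sum]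
      exact Finset.sum_congr rfl fun z _ => by ring
    rw [h4]
    refine Finset.sum_congr rfl fun l _ => ?_
    -- Index shift: the term `k = 0` vanishes through the factor `k`, and the extra top term through
    -- `c l n = 0`.
    have h5 : ∑ k ∈ Finset.range n, (k : ℂ) * (t : ℂ) ^ (k - 1) * c l k y =
        ∑ k ∈ Finset.range n, ((k + 1 : ℕ) : ℂ) * (t : ℂ) ^ k * c l (k + 1) y := by
      have h6 := Finset.sum_range_succ (fun k : ℕ => (k : ℂ) * (t : ℂ) ^ (k - 1) * c l k y) n
      rw [Finset.sum_range_succ', hn l n le_rfl] at h6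
      simpa using h6.symm
    have h7 : ∀ k : ℕ, ((k : ℂ) * (t : ℂ) ^ (k - 1) * Complex.exp (l * t) +
        (t : ℂ) ^ k * (Complex.exp (l * t) * l)) * c l k y =
        Complex.exp (l * t) * ((k : ℂ) * (t : ℂ) ^ (k - 1) * c l k y) +
          Complex.exp (l * t) * ((t : ℂ) ^ k * l * c l k y) := fun k => by ring
    have h8 : ∀ k : ℕ, (t : ℂ) ^ k * Complex.exp (l * t) *
        (l * c l k y + ((k + 1 : ℕ) : ℂ) * c l (k + 1) y) =
        Complex.exp (l * t) * (((k + 1 : ℕ) : ℂ) * (t : ℂ) ^ k * c l (k + 1) y) +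
          Complex.exp (l * t) * ((t : ℂ) ^ k * l * c l k y) := fun k => by ring
    simp only [h7, h8, Finset.sum_add_distrib, ← Finset.mul_sum, h5]
  have hU0 : ∀ y, U 0 y = (Pi.single x 1 : S → ℂ) y := by
    intro y
    rw [← hsum, Finset.sum_apply]
    refine Finset.sum_congr rfl fun l _ => ?_
    rcases Nat.eq_zero_or_pos n with h0 | hpos
    · subst h0
      simp [hn l 0 le_rfl]
    · rw [Finset.sum_eq_single_of_mem 0 (Finset.mem_range.2 hpos)]
      · simp
      · intro k _ hk
        simp [hk]
  intro T y
  -- `U` solves `U' = U L` from the unit vector at `x`. Uniqueness comes from `φ`, which is constant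
  -- and joins row `x` of the exponential to `U T`.
  set φ : ℝ → ℂ := fun t => ∑ z, U t z * (NormedSpace.exp ((T - t) • L) z y : ℂ) with hφ
  have hdφ : ∀ t, HasDerivAt φ 0 t := by
    intro t
    have h1 : ∀ z, HasDerivAt (fun t : ℝ => (NormedSpace.exp ((T - t) • L) z y : ℂ))
        (-((L * NormedSpace.exp ((T - t) • L)) z y : ℝ) : ℂ) t := by
      intro z
      have h2 := (Matrix.hasDerivAt_exp_apply L (T - t) z y).scomp t
        ((hasDerivAt_id t).const_sub T)
      rw [← Matrix.mul_exp_comm] at h2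
      simp only [neg_smul, one_smul] at h2
      simpa using h2.ofReal_comp
    have h3 : HasDerivAt φ (∑ z, ((∑ z', U t z' * (L z' z : ℂ)) *
        (NormedSpace.exp ((T - t) • L) z y : ℂ) +
        U t z * (-((L * NormedSpace.exp ((T - t) • L)) z y : ℝ) : ℂ))) t :=
      HasDerivAt.fun_sum fun z _ => (hdU t z).mul (h1 z)
    refine h3.congr_deriv ?_
    rw [Finset.sum_add_distrib]
    simp only [Matrix.mul_apply, Complex.ofReal_sum, Complex.ofReal_mul, mul_neg,
      Finset.sum_neg_distrib, Finset.sum_mul, Finset.mul_sum]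
    rw [Finset.sum_comm, add_neg_eq_zero]
    exact Finset.sum_congr rfl fun z _ => Finset.sum_congr rfl fun z' _ => by ring
  have h1 := is_const_of_deriv_eq_zero (fun s => (hdφ s).differentiableAt)
    (fun s => (hdφ s).deriv) 0 T
  have h2 : φ 0 = (NormedSpace.exp (T • L) x y : ℂ) := by
    simp [hφ, hU0, Pi.single_apply]
  have h3 : φ T = U T y := by
    simp [hφ, Matrix.one_apply, apply_ite]
  rw [← h2, h1, h3]

/-- Normalized rows of the exponential of a Metzler matrix converge to left eigenvectors. -/
theorem IsMetzler.exists_tendsto_normalized_row {L : Matrix S S ℝ} (hL : IsMetzler L) (x : S) :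
    ∃ (ν : S → ℝ) (s : ℝ), (∀ y, 0 ≤ ν y) ∧ ∑ y, ν y = 1 ∧ ν ᵥ* L = s • ν ∧
      ∀ y, Tendsto (fun t : ℝ => NormedSpace.exp (t • L) x y / ∑ z, NormedSpace.exp (t • L) x z)
        atTop (𝓝 (ν y)) := by
  obtain ⟨Λ, n, c, hΛ, hn, hexp, hchain⟩ := Matrix.exists_exp_apply_eq_sum L x
  -- the dominant pair of exponents
  set F : Finset (ℂ × ℕ) := (Λ ×ˢ Finset.range n).filter fun q => c q.1 q.2 ≠ 0 with hF
  have hmemF : ∀ l k, c l k ≠ 0 → (l, k) ∈ F := by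
    intro l k h
    simp only [hF, Finset.mem_filter, Finset.mem_product, Finset.mem_range]
    refine ⟨⟨?_, ?_⟩, h⟩
    · by_contra hl; exact h (hΛ l hl k)
    · by_contra hk; exact h (hn l k (not_lt.1 hk))
  have hFne : F.Nonempty := by
    by_contra hne
    rw [Finset.not_nonempty_iff_eq_empty] at hne
    have h0 : ∀ l k, c l k = 0 := by
      intro l k
      by_contra h
      have := hmemF l k h
      rw [hne] at this
      simp at this
    have := hexp 0 x
    simp [h0] at this
  obtain ⟨q₁, hq₁, hmax₁⟩ := F.exists_max_image (fun q => q.1.re) hFne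
  set s := q₁.1.re with hs
  have hF'ne : (F.filter fun q => q.1.re = s).Nonempty :=
    ⟨q₁, Finset.mem_filter.2 ⟨hq₁, rfl⟩⟩
  obtain ⟨q₂, hq₂, hmax₂⟩ := (F.filter fun q => q.1.re = s).exists_max_image (fun q => q.2) hF'ne
  set k₀ := q₂.2 with hk₀
  have hq₂re : q₂.1.re = s := (Finset.mem_filter.1 hq₂).2
  have hq₂ne : c q₂.1 k₀ ≠ 0 := (Finset.mem_filter.1 (Finset.mem_filter.1 hq₂).1).2
  have hre_le : ∀ l k, c l k ≠ 0 → l.re ≤ s := fun l k h => hmax₁ _ (hmemF l k h)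
  have hk_le : ∀ l k, c l k ≠ 0 → l.re = s → k ≤ k₀ := fun l k h hl =>
    hmax₂ (l, k) (Finset.mem_filter.2 ⟨hmemF l k h, hl⟩)
  -- asymptotics of the rescaled row
  set Λs : Finset ℂ := insert (s : ℂ) (Λ.filter fun l => l.re = s) with hΛs
  have hΛs_re : ∀ l ∈ Λs, l.re = s := by
    intro l hl
    rcases Finset.mem_insert.1 hl with h | h
    · rw [h, Complex.ofReal_re]
    · exact (Finset.mem_filter.1 h).2
  set b : ℝ → S → ℝ := fun t y => NormedSpace.exp (t • L) x y / (t ^ k₀ * Real.exp (s * t)) with hb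
  have hb0 : ∀ y t, 0 ≤ t → 0 ≤ b t y := fun y t ht =>
    div_nonneg (hL.exp_nonneg ht x y) (by positivity)
  have hlim : ∀ y, Tendsto (fun t : ℝ => (b t y : ℂ) -
      ∑ l ∈ Λs, Complex.exp ((l - s) * t) * c l k₀ y) atTop (𝓝 0) := by
    intro y
    have hterm : ∀ l ∈ Λ, ∀ k ∈ Finset.range n, Tendsto (fun t : ℝ =>
        (t : ℂ) ^ k * Complex.exp (l * t) * c l k y / ((t ^ k₀ * Real.exp (s * t) : ℝ) : ℂ) -
        (if l.re = s ∧ k = k₀ then Complex.exp ((l - s) * t) * c l k₀ y else 0)) atTop (𝓝 0) := by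
      intro l _ k _
      by_cases hlk : l.re = s ∧ k = k₀
      · obtain ⟨h1, rfl⟩ := hlk
        simp only [h1, and_self, if_true]
        refine tendsto_const_nhds.congr' ?_
        filter_upwards [eventually_gt_atTop 0] with t ht
        have ht' : (t : ℂ) ≠ 0 := by exact_mod_cast ht.ne'
        rw [eq_comm, sub_eq_zero, sub_mul, Complex.exp_sub]
        push_cast
        field_simp
      · simp only [hlk, if_false, sub_zero]
        by_cases hc : c l k = 0
        · simp [hc]
        have h1 : l.re < s ∨ l.re = s ∧ k < k₀ := by
          rcases (hre_le l k hc).lt_or_eq with h | h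
          · exact Or.inl h
          · exact Or.inr ⟨h, lt_of_le_of_ne (hk_le l k hc h) fun h' => hlk ⟨h, h'⟩⟩
        have h2 := (tendsto_pow_mul_exp_div h1).mul_const (c l k y)
        rw [zero_mul] at h2
        refine h2.congr fun t => ?_
        ring
    have hsum := tendsto_finsetSum Λ fun l hl =>
      tendsto_finsetSum (Finset.range n) fun k hk => hterm l hl k hk
    simp only [Finset.sum_const_zero] at hsum
    refine hsum.congr fun t => ?_
    simp only [Finset.sum_sub_distrib]
    congr 1
    · simp only [hb, Complex.ofReal_div, hexp, Finset.sum_div]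
    · have h3 : ∀ l ∈ Λ, (∑ k ∈ Finset.range n, if l.re = s ∧ k = k₀ then
          Complex.exp ((l - s) * t) * c l k₀ y else 0) =
          if l.re = s then Complex.exp ((l - s) * t) * c l k₀ y else 0 := by
        intro l _
        by_cases hl : l.re = s
        · simp only [hl, true_and, if_true, Finset.sum_ite_eq', Finset.mem_range]
          split_ifs with h
          · rfl
          · simp [hn l k₀ (not_lt.1 h)]
        · simp [hl]
      rw [Finset.sum_congr rfl h3, ← Finset.sum_filter]
      refine Finset.sum_subset (Finset.subset_insert _ _) fun l hl hl' => ?_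
      have h4 : l ∉ Λ := fun h => hl' (Finset.mem_filter.2 ⟨h, hΛs_re l hl⟩)
      simp [hΛ l h4]
  have hdom : ∀ y, ∀ l ∈ Λs, ‖c l k₀ y‖ ≤ (c s k₀ y).re := fun y l hl =>
    norm_coeff_le_of_nonneg Λs hΛs_re (Finset.mem_insert_self _ _) (fun l => c l k₀ y) (hb0 y)
      (hlim y) hl
  set p : S → ℝ := fun y => (c s k₀ y).re with hp
  have hp0 : ∀ y, 0 ≤ p y := fun y => (norm_nonneg _).trans (hdom y s (Finset.mem_insert_self _ _))
  have hcp : ∀ y, c s k₀ y = p y := by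
    intro y
    have h1 : |(c s k₀ y).re| = ‖c s k₀ y‖ :=
      le_antisymm (Complex.abs_re_le_norm _)
        ((hdom y s (Finset.mem_insert_self _ _)).trans (le_abs_self _))
    have h2 := Complex.abs_re_eq_norm.1 h1
    exact Complex.ext (by simp [hp]) (by simp [h2])
  -- Maximality of `k₀` kills the next vector of the chain, so the top coefficients are genuine left
  -- eigenvectors.
  have heig : ∀ l ∈ Λs, ∀ y, ∑ z, c l k₀ z * (L z y : ℂ) = l * c l k₀ y := by
    intro l hl y
    rw [hchain]
    have : c l (k₀ + 1) = 0 := by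
      by_contra h
      have := hk_le l (k₀ + 1) h (hΛs_re l hl)
      omega
    simp [this]
  have hpL : ∀ y, ∑ z, p z * L z y = s * p y := by
    intro y
    have := heig s (Finset.mem_insert_self _ _) y
    simp only [hcp] at this
    exact_mod_cast this
  have hzero : ∀ l ∈ Λs, l ≠ s → c l k₀ = 0 := by
    intro l hl hls
    by_contra hne
    exact hls (hL.eigenvalue_eq_of_dominated (hΛs_re l hl) (heig l hl) hpL
      (fun y => hdom y l hl) hne)
  have hq₂mem : q₂.1 ∈ Λs := by
    have := (Finset.mem_filter.1 (Finset.mem_filter.1 hq₂).1).1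
    exact Finset.mem_insert_of_mem
      (Finset.mem_filter.2 ⟨(Finset.mem_product.1 this).1, hq₂re⟩)
  have hq₂s : q₂.1 = s := by
    by_contra h
    exact hq₂ne (hzero _ hq₂mem h)
  have hblim : ∀ y, Tendsto (fun t => b t y) atTop (𝓝 (p y)) := by
    intro y
    have h1 : ∀ t : ℝ, ∑ l ∈ Λs, Complex.exp ((l - s) * t) * c l k₀ y = p y := by
      intro t
      rw [Finset.sum_eq_single_of_mem (s : ℂ) (Finset.mem_insert_self _ _)]
      · simp [hcp]
      · intro l hl hls
        simp [hzero l hl hls]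
    have h2 := hlim y
    simp only [h1] at h2
    have h3 := (Complex.continuous_re.tendsto _).comp (h2.add_const (p y : ℂ))
    simpa [Function.comp_def] using h3
  have hpsum : 0 < ∑ y, p y := by
    refine (Finset.sum_nonneg fun y _ => hp0 y).lt_of_ne' fun h => hq₂ne ?_
    have h1 := (Finset.sum_eq_zero_iff_of_nonneg fun y _ => hp0 y).1 h
    ext y
    rw [hq₂s, hcp, h1 y (Finset.mem_univ y)]
    simp
  refine ⟨fun y => p y / ∑ z, p z, s, fun y => div_nonneg (hp0 y) hpsum.le, ?_, ?_, fun y => ?_⟩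
  · rw [← Finset.sum_div, div_self hpsum.ne']
  · ext y
    simp only [Matrix.vecMul, dotProduct, Pi.smul_apply, smul_eq_mul, div_mul_eq_mul_div,
      ← Finset.sum_div, hpL]
    rw [mul_div_assoc]
  · have h1 := (hblim y).div (tendsto_finsetSum Finset.univ fun z _ => hblim z) hpsum.ne'
    refine h1.congr' ?_
    filter_upwards [eventually_gt_atTop 0] with t ht
    simp only [hb, Pi.div_apply, ← Finset.sum_div]
    rw [div_div_div_cancel_right₀ (by positivity)]

end QuasiLimit

/-! ### Grid approximation of the killed semigroup. -/

section Trotter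

open Matrix
open scoped Matrix.Norms.Operator

lemma norm_pow_sub_pow_le_of_norm_le_one {A : Type*} [SeminormedRing A] [NormOneClass A] {a b : A}
    (ha : ‖a‖ ≤ 1) (hb : ‖b‖ ≤ 1) (n : ℕ) : ‖a ^ n - b ^ n‖ ≤ n * ‖a - b‖ := by
  induction n with
  | zero => simp
  | succ n ih =>
    have h1 : a ^ (n + 1) - b ^ (n + 1) = a ^ n * (a - b) + (a ^ n - b ^ n) * b := by
      rw [pow_succ, pow_succ]; noncomm_ring
    have h2 : ‖a ^ n‖ ≤ 1 := (norm_pow_le a n).trans (pow_le_one₀ (norm_nonneg _) ha)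
    rw [h1]
    refine (norm_add_le _ _).trans ?_
    have h3 := norm_mul_le (a ^ n) (a - b)
    have h4 := norm_mul_le (a ^ n - b ^ n) b
    have h5 := mul_le_mul_of_nonneg_right h2 (norm_nonneg (a - b))
    have h6 := mul_le_mul_of_nonneg_left hb (norm_nonneg (a ^ n - b ^ n))
    push_cast
    linarith

variable {S : Type*} [Fintype S] {Q : Matrix S S ℝ}

lemma IsRateMatrix.sum_killed_nonpos (hQ : IsRateMatrix Q) (K : Set S) (x : S) :
    ∑ y, killed Q K x y ≤ 0 := by
  have h := hQ.killed_mulVec_one_nonpos K x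
  by_cases hx : x ∈ K
  · simp [killed_apply_of_mem_left Q hx]
  rw [killed_mulVec_of_notMem Q _ hx] at h
  refine le_of_eq_of_le (Finset.sum_congr rfl fun y _ => ?_) h
  by_cases hy : y ∈ K
  · simp [killed_apply_of_mem_right Q hy, hy]
  · simp [killed_apply_of_notMem Q hx hy, hy]

variable [DecidableEq S]

lemma Matrix.norm_le_one_of_substochastic {E : Matrix S S ℝ} (h0 : ∀ x y, 0 ≤ E x y)
    (h1 : ∀ x, ∑ y, E x y ≤ 1) : ‖E‖ ≤ 1 := by
  rw [Matrix.linfty_opNorm_def]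
  norm_cast
  refine Finset.sup_le fun x _ => ?_
  rw [← NNReal.coe_le_coe]
  push_cast
  refine le_of_eq_of_le (Finset.sum_congr rfl fun y _ => ?_) (h1 x)
  rw [Real.norm_of_nonneg (h0 x y)]

lemma IsMetzler.sum_exp_le_one {L : Matrix S S ℝ} (hL : IsMetzler L) (h : ∀ x, ∑ y, L x y ≤ 0)
    {t : ℝ} (ht : 0 ≤ t) (x : S) : ∑ y, NormedSpace.exp (t • L) x y ≤ 1 := by
  have hd := fun t => Matrix.hasDerivAt_exp_mulVec L (fun _ => (1 : ℝ)) t x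
  have hanti : AntitoneOn (fun t : ℝ => (NormedSpace.exp (t • L) *ᵥ fun _ => (1 : ℝ)) x)
      (Set.Ici 0) := by
    refine antitoneOn_of_deriv_nonpos (convex_Ici 0)
      (fun t _ => (hd t).continuousAt.continuousWithinAt)
      (fun t _ => (hd t).differentiableAt.differentiableWithinAt) fun t ht => ?_
    rw [interior_Ici] at ht
    rw [(hd t).deriv]
    have := Matrix.mulVec_mono (hL.exp_nonneg (le_of_lt ht)) (g := L *ᵥ fun _ => (1 : ℝ)) (g' := 0)
      (fun y => by simpa [Matrix.mulVec, dotProduct] using h y) x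
    simpa using this
  have h1 := hanti Set.self_mem_Ici (Set.mem_Ici.2 ht) ht
  simpa [Matrix.mulVec, dotProduct, Matrix.one_apply] using h1

lemma IsRateMatrix.sum_exp_eq_one (hQ : IsRateMatrix Q) (t : ℝ) (x : S) :
    ∑ y, NormedSpace.exp (t • Q) x y = 1 := by
  have hd := fun t => Matrix.hasDerivAt_exp_mulVec Q (fun _ => (1 : ℝ)) t x
  have h0 : (Q *ᵥ fun _ => (1 : ℝ)) = 0 := by
    ext y
    simpa [Matrix.mulVec, dotProduct] using hQ.row_sum y
  simp only [h0, Matrix.mulVec_zero, Pi.zero_apply] at hd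
  have := is_const_of_deriv_eq_zero (fun s => (hd s).differentiableAt) (fun s => (hd s).deriv) t 0
  simpa [Matrix.mulVec, dotProduct, Matrix.one_apply] using this

lemma killed_eq_mul (M : Matrix S S ℝ) (K : Set S) :
    killed M K = Matrix.diagonal (Kᶜ.indicator fun _ => (1 : ℝ)) * M *
      Matrix.diagonal (Kᶜ.indicator fun _ => (1 : ℝ)) := by
  ext x y
  rw [Matrix.mul_diagonal, Matrix.diagonal_mul]
  by_cases hx : x ∈ K
  · simp [killed_apply_of_mem_left M hx, hx]
  by_cases hy : y ∈ K
  · simp [killed_apply_of_mem_right M hy, hy]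
  simp [killed_apply_of_notMem M hx hy, hx, hy]

/-- Observing the killing only at times on a fine grid approximates the killed semigroup. -/
lemma IsRateMatrix.tendsto_grid (hQ : IsRateMatrix Q) (K : Set S) {t : ℝ} (ht : 0 ≤ t) {x y : S}
    (hx : x ∉ K) :
    Tendsto (fun k : ℕ => (killed (NormedSpace.exp ((t / 2 ^ k) • Q)) K ^ 2 ^ k) x y) atTop
      (𝓝 (NormedSpace.exp (t • killed Q K) x y)) := by
  have : Nonempty S := ⟨x⟩
  set D : Matrix S S ℝ := Matrix.diagonal (Kᶜ.indicator fun _ => (1 : ℝ)) with hD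
  have hDD : D * D = D := by
    rw [hD, Matrix.diagonal_mul_diagonal]
    congr 1
    ext z
    by_cases hz : z ∈ K <;> simp [hz]
  set L := killed Q K with hL
  have hLD : L = D * Q * D := killed_eq_mul Q K
  have hDL : D * L = L := by rw [hLD, ← mul_assoc, ← mul_assoc, hDD]
  have hLD' : L * D = L := by rw [hLD, mul_assoc, hDD]
  have hcomm : ∀ s : ℝ, Commute D (NormedSpace.exp (s • L)) := fun s =>
    (Commute.smul_right (show D * L = L * D by rw [hDL, hLD']) s).exp_right
  have hDn : ‖D‖ ≤ 1 := by
    refine Matrix.norm_le_one_of_substochastic (fun a b => ?_) fun a => ?_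
    · rw [hD, Matrix.diagonal_apply]
      split_ifs
      · exact Set.indicator_nonneg (fun _ _ => zero_le_one) a
      · exact le_rfl
    · simp only [hD, Matrix.diagonal_apply, Finset.sum_ite_eq, Finset.mem_univ, if_true]
      exact Set.indicator_le_self' (fun _ _ => zero_le_one) a
  have hEQ : ∀ s : ℝ, 0 ≤ s → ‖NormedSpace.exp (s • Q)‖ ≤ 1 := fun s hs =>
    Matrix.norm_le_one_of_substochastic (hQ.isMetzler.exp_nonneg hs)
      fun a => (hQ.sum_exp_eq_one s a).le
  have hEL : ∀ s : ℝ, 0 ≤ s → ‖NormedSpace.exp (s • L)‖ ≤ 1 := fun s hs =>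
    Matrix.norm_le_one_of_substochastic ((hQ.isMetzler_killed K).exp_nonneg hs)
      ((hQ.isMetzler_killed K).sum_exp_le_one (hQ.sum_killed_nonpos K) hs)
  have hA : ∀ s : ℝ, 0 ≤ s → ‖killed (NormedSpace.exp (s • Q)) K‖ ≤ 1 := by
    intro s hs
    rw [killed_eq_mul, ← hD]
    refine (norm_mul_le _ _).trans (mul_le_one₀ ?_ (norm_nonneg _) hDn)
    exact (norm_mul_le _ _).trans (mul_le_one₀ hDn (norm_nonneg _) (hEQ s hs))
  have hB : ∀ s : ℝ, 0 ≤ s → ‖D * NormedSpace.exp (s • L)‖ ≤ 1 := fun s hs =>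
    (norm_mul_le _ _).trans (mul_le_one₀ hDn (norm_nonneg _) (hEL s hs))
  -- Both terms equal `D` at `0` and have derivative `L` there, so `F s = o(s)`, and `2^k` steps of
  -- length `t / 2^k` accumulate an error tending to zero. The factor `D` is needed because `exp (s
  -- • L)` is the identity on `K`, whereas the killed one-step matrix is zero there.
  set F : ℝ → Matrix S S ℝ := fun s =>
    killed (NormedSpace.exp (s • Q)) K - D * NormedSpace.exp (s • L) with hF
  have hF0 : F 0 = 0 := by
    simp only [hF, Matrix.exp_zero_smul, killed_eq_mul, ← hD, mul_one, hDD, sub_self]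
  have hdF : HasDerivAt F 0 0 := by
    have h1 : HasDerivAt F (D * (NormedSpace.exp ((0 : ℝ) • Q) * Q) * D -
        D * (NormedSpace.exp ((0 : ℝ) • L) * L)) 0 := by
      simp only [hF, killed_eq_mul, ← hD]
      exact (((hasDerivAt_exp_smul_const Q (0 : ℝ)).const_mul D).mul_const D).sub
        ((hasDerivAt_exp_smul_const L (0 : ℝ)).const_mul D)
    refine h1.congr_deriv ?_
    rw [Matrix.exp_zero_smul, Matrix.exp_zero_smul, one_mul, one_mul, hDL, ← hLD, sub_self]
  have hlo := hasDerivAt_iff_isLittleO_nhds_zero.1 hdF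
  simp only [zero_add, hF0, sub_zero, smul_zero] at hlo
  have hδ : Tendsto (fun k : ℕ => t / 2 ^ k) atTop (𝓝 0) :=
    tendsto_const_nhds.div_atTop (tendsto_pow_atTop_atTop_of_one_lt one_lt_two)
  have hlim : Tendsto (fun k : ℕ => killed (NormedSpace.exp ((t / 2 ^ k) • Q)) K ^ 2 ^ k -
      (D * NormedSpace.exp ((t / 2 ^ k) • L)) ^ 2 ^ k) atTop (𝓝 0) := by
    refine Metric.tendsto_nhds.2 fun ε hε => ?_
    -- Dividing by `t + 1` rather than `t` covers `t = 0`.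
    have h1 := hδ.eventually (hlo.def (c := ε / (t + 1)) (by positivity))
    filter_upwards [h1] with k hk
    rw [dist_zero_right]
    refine (norm_pow_sub_pow_le_of_norm_le_one (hA _ (by positivity)) (hB _ (by positivity))
      (2 ^ k)).trans_lt ?_
    rw [Real.norm_of_nonneg (by positivity)] at hk
    refine (mul_le_mul_of_nonneg_left hk (by positivity)).trans_lt ?_
    push_cast
    have h2 : (2 : ℝ) ^ k * (ε / (t + 1) * (t / 2 ^ k)) = ε * (t / (t + 1)) := by field_simp
    rw [h2]
    refine mul_lt_of_lt_one_right hε ?_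
    rw [div_lt_one (by positivity)]
    linarith
  have hpow : ∀ k : ℕ, ((D * NormedSpace.exp ((t / 2 ^ k) • L)) ^ 2 ^ k) x y =
      NormedSpace.exp (t • L) x y := by
    intro k
    have hDpow : ∀ n : ℕ, n ≠ 0 → D ^ n = D := fun n hn => IsIdempotentElem.pow_eq hDD hn
    rw [(hcomm _).mul_pow, hDpow _ (by positivity), ← Matrix.exp_nsmul, ← Nat.cast_smul_eq_nsmul ℝ,
      smul_smul, hD, Matrix.diagonal_mul]
    have h1 : ((2 ^ k : ℕ) : ℝ) * (t / 2 ^ k) = t := by push_cast; field_simp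
    rw [h1]
    simp [hx]
  have h3 := (tendsto_pi_nhds.1 ((tendsto_pi_nhds.1 hlim) x)) y
  have h4 := h3.add_const (NormedSpace.exp (t • L) x y)
  simp only [Matrix.sub_apply, hpow, sub_add_cancel, Matrix.zero_apply, zero_add] at h4
  exact h4

/-- Entries of matrix powers as sums over paths. -/
lemma Matrix.pow_apply_eq_sum_paths (M : Matrix S S ℝ) (N : ℕ) (x z : S) :
    (M ^ N) x z = ∑ p : Fin (N + 1) → S, if p 0 = x ∧ p (Fin.last N) = z then
      ∏ i : Fin N, M (p i.castSucc) (p i.succ) else 0 := by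
  induction N generalizing x with
  | zero =>
    rw [← (Equiv.funUnique (Fin 1) S).symm.sum_comp]
    simp only [pow_zero, Matrix.one_apply]
    rw [Finset.sum_eq_single x]
    · simp
    · intro b _ hb
      simp [hb]
    · simp
  | succ N ih =>
    rw [pow_succ', Matrix.mul_apply, ← (Fin.consEquiv fun _ => S).sum_comp, Fintype.sum_prod_type]
    conv_rhs => rw [Finset.sum_eq_single_of_mem x (Finset.mem_univ x)
      (by intro a _ ha; simp [Fin.consEquiv, ha])]
    simp only [ih, Finset.mul_sum]
    rw [Finset.sum_comm]
    refine Finset.sum_congr rfl fun p _ => ?_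
    rw [Finset.sum_eq_single (p 0)]
    · simp [Fin.consEquiv, Fin.prod_univ_succ, ← Fin.succ_last]
    · intro w _ hw
      simp [hw.symm]
    · simp

end Trotter

/-! ### Hitting times of right-continuous paths. -/

section HittingTimes

variable {S Ω : Type*}

/-- The strict inequality is where right-continuity enters: a path outside `K` at time `t` stays at
its position on some `[t, u)`, so the infimum is at least `u`. -/
lemma lt_hittingTime_iff {X : ℝ≥0 → Ω → S} {ω : Ω}
    (hX : ∀ t, ∀ᶠ s in 𝓝[≥] t, X s ω = X t ω) (K : Set S) (t : ℝ≥0) :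
    (t : ℝ≥0∞) < hittingTime X K ω ↔ ∀ s ≤ t, X s ω ∉ K := by
  constructor
  · intro h s hs hK
    have h1 : hittingTime X K ω ≤ (s : ℝ≥0∞) := iInf₂_le s hK
    exact absurd (h.trans_le h1) (not_lt.2 (by exact_mod_cast hs))
  · intro h
    obtain ⟨u, hu, hsub⟩ := mem_nhdsGE_iff_exists_Ico_subset.1 (hX t)
    have hu' : t < u := hu
    refine lt_of_lt_of_le (ENNReal.coe_lt_coe.2 hu') (le_iInf₂ fun s hs => ?_)
    have h1 : u ≤ s := by
      by_contra! hlt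
      rcases le_total s t with h2 | h2
      · exact h s h2 hs
      · have h3 : X s ω = X t ω := hsub ⟨h2, hlt⟩
        rw [h3] at hs
        exact h t le_rfl hs
    exact_mod_cast h1

/-- A path in `K` at time `s` remains there on some `[s, u)`, which contains a point of any grid of
mesh below `u - s`. This reduces avoidance of `K` to countably many times. -/
lemma forall_notMem_iff_dyadic {X : ℝ≥0 → Ω → S} {ω : Ω}
    (hX : ∀ t, ∀ᶠ s in 𝓝[≥] t, X s ω = X t ω) (K : Set S) (t : ℝ≥0) :
    (∀ s ≤ t, X s ω ∉ K) ↔ ∀ k i : ℕ, i ≤ 2 ^ k → X (i * (t / 2 ^ k)) ω ∉ K := by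
  constructor
  · intro h k i hi
    refine h _ ?_
    calc (i : ℝ≥0) * (t / 2 ^ k) ≤ (2 ^ k : ℕ) * (t / 2 ^ k) := by gcongr
      _ = t := by push_cast; field_simp
  · intro h s hs hK
    rcases eq_or_ne t 0 with rfl | ht
    · have := h 0 0 (by simp)
      rw [nonpos_iff_eq_zero.1 hs] at hK
      simp at this
      exact this hK
    have htpos : 0 < t := pos_iff_ne_zero.2 ht
    obtain ⟨u, hu, hsub⟩ := mem_nhdsGE_iff_exists_Ico_subset.1 (hX s)
    have hu' : s < u := hu
    have hlim : Tendsto (fun k : ℕ => (t : ℝ) / 2 ^ k) atTop (𝓝 0) :=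
      tendsto_const_nhds.div_atTop (tendsto_pow_atTop_atTop_of_one_lt one_lt_two)
    have hpos : (0 : ℝ) < u - s := sub_pos.2 (by exact_mod_cast hu')
    obtain ⟨k, hk⟩ := (hlim.eventually (gt_mem_nhds hpos)).exists
    set δ : ℝ≥0 := t / 2 ^ k with hδ
    have hδpos : 0 < δ := by positivity
    have hδ' : s + δ < u := by
      rw [← NNReal.coe_lt_coe]; push_cast [hδ]; linarith
    have hle : ⌈s / δ⌉₊ ≤ 2 ^ k := by
      rw [Nat.ceil_le, div_le_iff₀ hδpos]
      refine hs.trans (le_of_eq ?_)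
      rw [hδ]; push_cast; field_simp
    -- The first grid point not before `s`; it does not pass `t`, since `t` itself is a grid point.
    refine h k ⌈s / δ⌉₊ hle ?_
    have h1 : s ≤ ⌈s / δ⌉₊ * δ := by
      rw [← div_le_iff₀ hδpos]; exact Nat.le_ceil _
    have h2 : ⌈s / δ⌉₊ * δ < u := by
      have h3 : (⌈s / δ⌉₊ : ℝ≥0) < s / δ + 1 := Nat.ceil_lt_add_one zero_le
      calc ⌈s / δ⌉₊ * δ < (s / δ + 1) * δ := by gcongr
        _ = s + δ := by field_simp
        _ < u := hδ'
    have h4 : X (⌈s / δ⌉₊ * δ) ω = X s ω := hsub ⟨h1, h2⟩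
    rw [h4]
    exact hK

/-- Layer cake by Tonelli: `a` is the length of `{t > 0 : t < a}`, including `a = ∞`. -/
lemma lintegral_eq_lintegral_ofReal_lt [MeasurableSpace Ω] (μ : Measure Ω) [SFinite μ]
    {f : Ω → ℝ≥0∞} (hf : Measurable f) :
    ∫⁻ ω, f ω ∂μ = ∫⁻ t in Set.Ioi (0 : ℝ), μ {ω | ENNReal.ofReal t < f ω} := by
  have h1 : ∀ a : ℝ≥0∞, a = ∫⁻ t in Set.Ioi (0 : ℝ),
      {t : ℝ | ENNReal.ofReal t < a}.indicator (fun _ => 1) t := by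
    intro a
    have hm : MeasurableSet {t : ℝ | ENNReal.ofReal t < a} :=
      measurableSet_lt ENNReal.measurable_ofReal measurable_const
    rw [lintegral_indicator_const hm, one_mul, Measure.restrict_apply hm]
    rcases eq_or_ne a ⊤ with rfl | ha
    · simp
    · have h2 : {t : ℝ | ENNReal.ofReal t < a} ∩ Set.Ioi 0 = Set.Ioo 0 a.toReal := by
        ext t
        simp only [Set.mem_inter_iff, Set.mem_ofPred_eq, Set.mem_Ioi, Set.mem_Ioo]
        constructor
        · rintro ⟨h, h0⟩
          exact ⟨h0, (ENNReal.ofReal_lt_iff_lt_toReal h0.le ha).1 h⟩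
        · rintro ⟨h0, h⟩
          exact ⟨(ENNReal.ofReal_lt_iff_lt_toReal h0.le ha).2 h, h0⟩
      rw [h2, Real.volume_Ioo, sub_zero, ENNReal.ofReal_toReal ha]
  have hmeas : MeasurableSet {p : Ω × ℝ | ENNReal.ofReal p.2 < f p.1} :=
    measurableSet_lt (ENNReal.measurable_ofReal.comp measurable_snd) (hf.comp measurable_fst)
  calc ∫⁻ ω, f ω ∂μ = ∫⁻ ω, (∫⁻ t in Set.Ioi (0 : ℝ),
      {t : ℝ | ENNReal.ofReal t < f ω}.indicator (fun _ => 1) t) ∂μ :=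
        lintegral_congr fun ω => h1 (f ω)
    _ = ∫⁻ t in Set.Ioi (0 : ℝ), ∫⁻ ω,
      {t : ℝ | ENNReal.ofReal t < f ω}.indicator (fun _ => 1) t ∂μ := by
        refine lintegral_lintegral_swap ?_
        have : (Function.uncurry fun (ω : Ω) (t : ℝ) =>
            {t : ℝ | ENNReal.ofReal t < f ω}.indicator (fun _ => (1 : ℝ≥0∞)) t) =
            {p : Ω × ℝ | ENNReal.ofReal p.2 < f p.1}.indicator fun _ => 1 := by
          ext p; rfl
        rw [this]
        exact (measurable_const.indicator hmeas).aemeasurable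
    _ = _ := by
        refine lintegral_congr fun t => ?_
        have hm : MeasurableSet {ω | ENNReal.ofReal t < f ω} := measurableSet_lt measurable_const hf
        have : (fun ω => {t : ℝ | ENNReal.ofReal t < f ω}.indicator (fun _ => (1 : ℝ≥0∞)) t) =
            {ω | ENNReal.ofReal t < f ω}.indicator fun _ => 1 := by
          ext ω; rfl
        rw [this, lintegral_indicator_const hm, one_mul]

end HittingTimes

/-! ### Laws of the killed paths and of the hitting times. -/

namespace IsMarkovChainFrom

variable {S Ω : Type*} [Fintype S] [DecidableEq S] [MeasurableSpace Ω] {Q : Matrix S S ℝ} {x : S}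
  {P : Measure Ω} {X : ℝ≥0 → Ω → S}

lemma measurableSet_mem (hX : IsMarkovChainFrom Q x P X) (t : ℝ≥0) (K : Set S) :
    MeasurableSet {ω | X t ω ∈ K} := by
  have : {ω | X t ω ∈ K} = ⋃ y ∈ K, {ω | X t ω = y} := by ext; simp
  rw [this]
  exact MeasurableSet.biUnion (Set.to_countable K) fun y _ => hX.measurable t y

lemma measurableSet_lt_hittingTime (hX : IsMarkovChainFrom Q x P X) (t : ℝ≥0) (K : Set S) :
    MeasurableSet {ω | (t : ℝ≥0∞) < hittingTime X K ω} := by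
  have : {ω | (t : ℝ≥0∞) < hittingTime X K ω} =
      ⋂ (k : ℕ) (i : ℕ) (_ : i ≤ 2 ^ k), {ω | X (i * (t / 2 ^ k)) ω ∈ K}ᶜ := by
    ext ω
    simp only [Set.mem_ofPred_eq, lt_hittingTime_iff (hX.right_continuous ω),
      forall_notMem_iff_dyadic (hX.right_continuous ω), Set.mem_iInter, Set.mem_compl_iff]
  rw [this]
  exact MeasurableSet.iInter fun k => MeasurableSet.iInter fun i => MeasurableSet.iInter fun _ =>
    (hX.measurableSet_mem _ K).compl

lemma measurable_hittingTime (hX : IsMarkovChainFrom Q x P X) (K : Set S) :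
    Measurable (hittingTime X K) := by
  refine measurable_of_Ioi fun a => ?_
  rcases eq_or_ne a ⊤ with rfl | ha
  · simp
  · lift a to ℝ≥0 using ha
    exact hX.measurableSet_lt_hittingTime a K

lemma ae_start [IsProbabilityMeasure P] (hX : IsMarkovChainFrom Q x P X) :
    ∀ᵐ ω ∂P, X 0 ω = x := by
  have h := hX.finite_dim 0 (fun _ => 0) (fun _ => x) monotone_const rfl rfl
  simp only [forall_const, Finset.univ_eq_empty, Finset.prod_empty, ENNReal.ofReal_one] at h
  exact (prob_compl_eq_zero_iff (hX.measurable 0 x)).2 h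

/-- The law of the chain observed and killed on a grid. -/
lemma measureReal_grid [IsProbabilityMeasure P] (hQ : IsRateMatrix Q)
    (hX : IsMarkovChainFrom Q x P X) (K : Set S) {y : S} (δ : ℝ≥0) {N : ℕ} (hN : N ≠ 0) :
    P.real {ω | X (N * δ) ω = y ∧ ∀ i : ℕ, i ≤ N → X (i * δ) ω ∉ K} =
      (killed (semigroup Q δ) K ^ N) x y := by
  classical
  set t : Fin (N + 1) → ℝ≥0 := fun i => (i : ℕ) * δ with ht
  have htmono : Monotone t := fun i j hij => by
    simp only [ht]
    gcongr
    exact hij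
  have ht0 : t 0 = 0 := by simp [ht]
  set E : (Fin (N + 1) → S) → Set Ω := fun p => {ω | ∀ i, X (t i) ω = p i} with hE
  set F : Finset (Fin (N + 1) → S) :=
    Finset.univ.filter fun p => (p 0 = x ∧ p (Fin.last N) = y) ∧ ∀ i, p i ∉ K with hF
  have hEmeas : ∀ p, MeasurableSet (E p) := by
    intro p
    have : E p = ⋂ i, {ω | X (t i) ω = p i} := by ext; simp [hE]
    rw [this]
    exact MeasurableSet.iInter fun i => hX.measurable _ _
  -- Equality holds only almost surely, because the paths start at `x` only almost surely.
  have hunion : {ω | X (N * δ) ω = y ∧ ∀ i : ℕ, i ≤ N → X (i * δ) ω ∉ K} =ᵐ[P] ⋃ p ∈ F, E p := by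
    filter_upwards [hX.ae_start] with ω hω
    apply propext
    change (X (N * δ) ω = y ∧ ∀ i : ℕ, i ≤ N → X (i * δ) ω ∉ K) ↔ ω ∈ ⋃ p ∈ F, E p
    simp only [Set.mem_iUnion, hF, Finset.mem_filter, Finset.mem_univ, true_and, exists_prop]
    constructor
    · rintro ⟨h1, h2⟩
      refine ⟨fun i => X (t i) ω, ⟨⟨?_, ?_⟩, fun i => ?_⟩, fun i => rfl⟩
      · simp only [ht0, hω]
      · simpa [ht] using h1
      · exact h2 i (Nat.lt_succ_iff.1 i.2)
    · rintro ⟨p, ⟨⟨h0, h1⟩, h2⟩, h3⟩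
      refine ⟨?_, fun i hi => ?_⟩
      · have := h3 (Fin.last N)
        rw [h1] at this
        simpa [ht] using this
      · have := h3 ⟨i, Nat.lt_succ_iff.2 hi⟩
        have h4 := h2 ⟨i, Nat.lt_succ_iff.2 hi⟩
        rw [← this] at h4
        exact h4
  have hnn : ∀ (s : ℝ≥0) a b, 0 ≤ semigroup Q s a b := fun s a b =>
    hQ.isMetzler.exp_nonneg s.2 a b
  have hstep : ∀ i : Fin N, t i.succ - t i.castSucc = δ := by
    intro i
    simp only [ht, Fin.val_succ, Fin.val_castSucc]
    push_cast
    rw [add_mul, one_mul, add_tsub_cancel_left]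
  have hval : ∀ p : Fin (N + 1) → S, p 0 = x →
      P.real (E p) = ∏ i : Fin N, semigroup Q δ (p i.castSucc) (p i.succ) := by
    intro p hp
    rw [measureReal_def, hE, hX.finite_dim N t p htmono ht0 hp,
      ENNReal.toReal_ofReal (Finset.prod_nonneg fun i _ => hnn _ _ _)]
    exact Finset.prod_congr rfl fun i _ => by rw [hstep]
  rw [measureReal_congr hunion, measureReal_biUnion_finset _ fun p _ => hEmeas p,
    Matrix.pow_apply_eq_sum_paths, ← Finset.sum_filter, hF, ← Finset.filter_filter,
    Finset.sum_filter]
  · refine Finset.sum_congr rfl fun p hp => ?_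
    have hp0 : p 0 = x := (Finset.mem_filter.1 hp).2.1
    split_ifs with h
    · rw [hval p hp0]
      exact Finset.prod_congr rfl fun i _ => (killed_apply_of_notMem _ (h _) (h _)).symm
    -- A path visiting `K` has a vanishing factor: the step leaving the visited point or, if that
    -- point is the last, the step entering it. The latter needs at least one step, hence `N ≠ 0`.
    · push Not at h
      obtain ⟨j, hj⟩ := h
      obtain ⟨M, rfl⟩ := Nat.exists_eq_succ_of_ne_zero hN
      rw [eq_comm]
      rcases Fin.eq_castSucc_or_eq_last j with ⟨i, rfl⟩ | rfl
      · exact Finset.prod_eq_zero (Finset.mem_univ i) (killed_apply_of_mem_left _ hj _)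
      · refine Finset.prod_eq_zero (Finset.mem_univ (Fin.last M))
          (killed_apply_of_mem_right _ ?_ _)
        rwa [Fin.succ_last]
  · intro p _ q _ hpq
    refine Set.disjoint_left.2 fun ω hp hq => hpq ?_
    ext i
    rw [← hp i, ← hq i]

/-- The law of the chain killed on `K`. -/
lemma measureReal_eq_and_lt_hittingTime [IsProbabilityMeasure P] (hQ : IsRateMatrix Q)
    (hX : IsMarkovChainFrom Q x P X) {K : Set S} (hx : x ∉ K) (y : S) (t : ℝ≥0) :
    P.real {ω | X t ω = y ∧ (t : ℝ≥0∞) < hittingTime X K ω} =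
      NormedSpace.exp ((t : ℝ) • killed Q K) x y := by
  set E : ℕ → Set Ω := fun k =>
    {ω | X ((2 ^ k : ℕ) * (t / 2 ^ k)) ω = y ∧ ∀ i : ℕ, i ≤ 2 ^ k → X (i * (t / 2 ^ k)) ω ∉ K} with hE
  have hlast : ∀ k : ℕ, ((2 ^ k : ℕ) : ℝ≥0) * (t / 2 ^ k) = t := by
    intro k; push_cast; field_simp
  have hInter : {ω | X t ω = y ∧ (t : ℝ≥0∞) < hittingTime X K ω} = ⋂ k, E k := by
    ext ω
    simp only [Set.mem_ofPred_eq, lt_hittingTime_iff (hX.right_continuous ω),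
      forall_notMem_iff_dyadic (hX.right_continuous ω), hE, hlast, Set.mem_iInter]
    exact ⟨fun h k => ⟨h.1, h.2 k⟩, fun h => ⟨(h 0).1, fun k => (h k).2⟩⟩
  have hmeas : ∀ k, MeasurableSet (E k) := by
    intro k
    have : E k = {ω | X ((2 ^ k : ℕ) * (t / 2 ^ k)) ω = y} ∩
        ⋂ (i : ℕ) (_ : i ≤ 2 ^ k), {ω | X (i * (t / 2 ^ k)) ω ∈ K}ᶜ := by
      ext ω; simp [hE]
    rw [this]
    exact (hX.measurable _ _).inter (MeasurableSet.iInter fun i => MeasurableSet.iInter fun _ =>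
      (hX.measurableSet_mem _ K).compl)
  -- Dyadic grids are nested, so the avoidance events decrease to the true one. Continuity of the
  -- measure from above and the grid approximation give two limits of the same sequence.
  have hanti : Antitone E := by
    refine antitone_nat_of_succ_le fun k ω hω => ?_
    simp only [hE, hlast, Set.mem_ofPred_eq] at hω ⊢
    refine ⟨hω.1, fun i hi => ?_⟩
    have h1 := hω.2 (2 * i) (by rw [pow_succ]; omega)
    have h2 : ((2 * i : ℕ) : ℝ≥0) * (t / 2 ^ (k + 1)) = i * (t / 2 ^ k) := by
      push_cast
      rw [pow_succ]
      field_simp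
    rwa [h2] at h1
  have h1 := tendsto_measure_iInter_atTop (μ := P) (fun k => (hmeas k).nullMeasurableSet) hanti
    ⟨0, measure_ne_top _ _⟩
  rw [← hInter] at h1
  have h2 := (ENNReal.tendsto_toReal (measure_ne_top P _)).comp h1
  have h3 : ∀ k : ℕ, P.real (E k) =
      (killed (NormedSpace.exp (((t : ℝ) / 2 ^ k) • Q)) K ^ 2 ^ k) x y := by
    intro k
    have h4 := hX.measureReal_grid hQ K (y := y) (t / 2 ^ k) (N := 2 ^ k) (by positivity)
    simpa [semigroup, hE] using h4
  refine tendsto_nhds_unique h2 ?_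
  refine (hQ.tendsto_grid K t.coe_nonneg hx).congr fun k => ?_
  rw [← h3]
  rfl

lemma measureReal_lt_hittingTime [IsProbabilityMeasure P] (hQ : IsRateMatrix Q)
    (hX : IsMarkovChainFrom Q x P X) (K : Set S) (t : ℝ≥0) :
    P.real {ω | (t : ℝ≥0∞) < hittingTime X K ω} = survival Q K t x := by
  by_cases hx : x ∈ K
  · rw [survival_of_mem Q hx, measureReal_eq_zero_iff]
    refine measure_eq_zero_iff_ae_notMem.2 (hX.ae_start.mono fun ω h0 hω => ?_)
    have := (lt_hittingTime_iff (hX.right_continuous ω) K t).1 hω 0 zero_le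
    rw [h0] at this
    exact this hx
  · have hunion : {ω | (t : ℝ≥0∞) < hittingTime X K ω} =
        ⋃ y ∈ (Finset.univ : Finset S), {ω | X t ω = y ∧ (t : ℝ≥0∞) < hittingTime X K ω} := by
      ext ω; simp
    rw [hunion, measureReal_biUnion_finset]
    · simp only [survival, Matrix.mulVec, dotProduct]
      refine Finset.sum_congr rfl fun y _ => ?_
      rw [hX.measureReal_eq_and_lt_hittingTime hQ hx]
      by_cases hy : y ∈ K
      · have hxy : x ≠ y := by rintro rfl; exact hx hy
        rw [exp_killed_apply_of_mem_right Q hy, Matrix.one_apply_ne hxy, zero_mul]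
      · simp [hy]
    · intro a _ b _ hab
      exact Set.disjoint_left.2 fun ω ha hb => hab (ha.1.symm.trans hb.1)
    · exact fun y _ => (hX.measurable t y).inter (hX.measurableSet_lt_hittingTime t K)

lemma measureReal_hittingTime_le [IsProbabilityMeasure P] (hQ : IsRateMatrix Q)
    (hX : IsMarkovChainFrom Q x P X) (K : Set S) (t : ℝ≥0) :
    P.real {ω | hittingTime X K ω ≤ (t : ℝ≥0∞)} = 1 - survival Q K t x := by
  rw [← hX.measureReal_lt_hittingTime hQ K t,
    ← probReal_compl_eq_one_sub (hX.measurableSet_lt_hittingTime t K)]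
  congr 1
  ext ω
  simp

lemma measureReal_eq [IsProbabilityMeasure P] (hQ : IsRateMatrix Q)
    (hX : IsMarkovChainFrom Q x P X) (y : S) (t : ℝ≥0) :
    P.real {ω | X t ω = y} = NormedSpace.exp ((t : ℝ) • Q) x y := by
  have h := hX.measureReal_eq_and_lt_hittingTime hQ (K := ∅) (by simp) y t
  rw [killed_empty] at h
  rw [← h]
  simp [hittingTime]

lemma lintegral_hittingTime [IsProbabilityMeasure P] (hQ : IsRateMatrix Q)
    (hX : IsMarkovChainFrom Q x P X) {K : Set S} {h : S → ℝ} (hh : IsMeanTime Q K h) :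
    ∫⁻ ω, hittingTime X K ω ∂P = ENNReal.ofReal (h x) := by
  rw [lintegral_eq_lintegral_ofReal_lt P (hX.measurable_hittingTime K),
    ← hh.lintegral_survival hQ x]
  refine setLIntegral_congr_fun measurableSet_Ioi fun t ht => ?_
  have h1 := hX.measureReal_lt_hittingTime hQ K (Real.toNNReal t)
  rw [Real.coe_toNNReal t (le_of_lt ht)] at h1
  rw [← h1, ofReal_measureReal]
  rfl

end IsMarkovChainFrom

/-! ### Positivity of the invariant measure and time reversal. -/

section Reversal

open Matrix
open scoped Matrix.Norms.Operator

variable {S : Type*} [Fintype S] {Q : Matrix S S ℝ} {π : S → ℝ}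

/-- Invariance at a zero of `π` forces `π` to vanish at every state that jumps there; by
irreducibility `π` would vanish everywhere. -/
lemma IsInvariantProb.pos (hQ : IsRateMatrix Q) (hirr : IsIrreducibleRate Q)
    (hπ : IsInvariantProb Q π) (x : S) : 0 < π x := by
  refine (hπ.nonneg x).lt_of_ne' fun h0 => ?_
  have hstep : ∀ a b, π b = 0 → 0 < Q a b → π a = 0 := by
    intro a b hb hab
    have h1 : ∀ z ∈ Finset.univ, 0 ≤ π z * Q z b := by
      intro z _
      by_cases hz : z = b
      · rw [hz, hb, zero_mul]
      · exact mul_nonneg (hπ.nonneg z) (hQ.nonneg z b hz)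
    have h2 := (Finset.sum_eq_zero_iff_of_nonneg h1).1 (hπ.invariant b) a (Finset.mem_univ a)
    exact (mul_eq_zero.1 h2).resolve_right hab.ne'
  have hall : ∀ a, π a = 0 := by
    intro a
    refine (hirr a x).head_induction_on h0 fun hab _ hb => hstep _ _ hb hab
  have := hπ.sum_one
  simp [hall] at this

lemma IsInvariantProb.isRateMatrix_reversedRate (hQ : IsRateMatrix Q) (hπ : IsInvariantProb Q π) :
    IsRateMatrix (reversedRate Q π) where
  nonneg x y hxy := mul_nonneg (div_nonneg (hπ.nonneg y) (hπ.nonneg x)) (hQ.nonneg y x hxy.symm)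
  row_sum x := by
    have h : ∀ y, reversedRate Q π x y = π y * Q y x / π x := fun y => by
      simp only [reversedRate, Matrix.of_apply]; ring
    simp only [h, ← Finset.sum_div, hπ.invariant, zero_div]

variable [DecidableEq S]

/-- The killed reversed generator is the transpose of the killed generator conjugated by the
diagonal matrix of `π`, and the exponential respects both operations. -/
lemma exp_killed_reversedRate (hπ : ∀ x, 0 < π x) (K : Set S) (t : ℝ) (x y : S) :
    π x * NormedSpace.exp (t • killed (reversedRate Q π) K) x y =
      π y * NormedSpace.exp (t • killed Q K) y x := by
  let U : (Matrix S S ℝ)ˣ :=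
    ⟨Matrix.diagonal fun x => (π x)⁻¹, Matrix.diagonal π, by
      rw [Matrix.diagonal_mul_diagonal, ← Matrix.diagonal_one]
      congr 1; ext z; exact inv_mul_cancel₀ (hπ z).ne', by
      rw [Matrix.diagonal_mul_diagonal, ← Matrix.diagonal_one]
      congr 1; ext z; exact mul_inv_cancel₀ (hπ z).ne'⟩
  have hconj : t • killed (reversedRate Q π) K =
      (U : Matrix S S ℝ) * (t • killed Q K)ᵀ * ((U⁻¹ : (Matrix S S ℝ)ˣ) : Matrix S S ℝ) := by
    ext a b
    change _ = (Matrix.diagonal (fun x => (π x)⁻¹) * (t • killed Q K)ᵀ * Matrix.diagonal π) a b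
    rw [Matrix.mul_diagonal, Matrix.diagonal_mul, Matrix.transpose_apply, Matrix.smul_apply,
      Matrix.smul_apply, smul_eq_mul, smul_eq_mul]
    by_cases ha : a ∈ K
    · simp [killed_apply_of_mem_left _ ha, killed_apply_of_mem_right _ ha]
    by_cases hb : b ∈ K
    · simp [killed_apply_of_mem_left _ hb, killed_apply_of_mem_right _ hb]
    rw [killed_apply_of_notMem _ ha hb, killed_apply_of_notMem _ hb ha]
    simp only [reversedRate, Matrix.of_apply]
    ring
  rw [hconj, Matrix.exp_units_conj, Matrix.exp_transpose]
  change π x * (Matrix.diagonal (fun x => (π x)⁻¹) * (NormedSpace.exp (t • killed Q K))ᵀ *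
    Matrix.diagonal π) x y = _
  rw [Matrix.mul_diagonal, Matrix.diagonal_mul, Matrix.transpose_apply]
  have := (hπ x).ne'
  field_simp

/-- The chain and its time reversal, started from the invariant measure, avoid `K` with the same
probability. -/
lemma sum_mul_survival_reversedRate (hπ : ∀ x, 0 < π x) (K : Set S) (t : ℝ) :
    ∑ x, π x * survival (reversedRate Q π) K t x = ∑ x, π x * survival Q K t x := by
  have h : ∀ Q' : Matrix S S ℝ, ∑ x, π x * survival Q' K t x =
      ∑ x, ∑ y, Kᶜ.indicator (fun _ => (1 : ℝ)) x * Kᶜ.indicator (fun _ => (1 : ℝ)) y *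
        (π x * NormedSpace.exp (t • killed Q' K) x y) := by
    intro Q'
    refine Finset.sum_congr rfl fun x _ => ?_
    by_cases hx : x ∈ K
    · simp [survival_of_mem Q' hx, hx]
    · simp only [survival, Matrix.mulVec, dotProduct, Finset.mul_sum]
      refine Finset.sum_congr rfl fun y _ => ?_
      rw [Set.indicator_of_mem (s := Kᶜ) (a := x) hx]
      ring
  rw [h, h, Finset.sum_comm]
  refine Finset.sum_congr rfl fun y _ => Finset.sum_congr rfl fun x _ => ?_
  rw [exp_killed_reversedRate hπ, mul_comm (Kᶜ.indicator (fun _ => (1 : ℝ)) y)]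

lemma IsInvariantProb.sum_mul_exp (hπ : IsInvariantProb Q π) (t : ℝ) (y : S) :
    ∑ x, π x * NormedSpace.exp (t • Q) x y = π y := by
  have h : π ᵥ* Q = (0 : ℝ) • π := by
    ext y
    simpa [Matrix.vecMul, dotProduct] using hπ.invariant y
  have := Matrix.vecMul_exp_of_eigen h t y
  simpa [Matrix.vecMul, dotProduct] using this

end Reversal

/-! ### Quantitative estimates on mean hitting times and survival. -/

section Estimates

/-- Equal masses allow `h` to be recentred at `H / 2`. Its absolute value is then at most `H / 2`,
so the constant is `H` and not `2 H`. -/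
lemma sum_sub_mul_le_tvDist {S : Type*} [Fintype S] {a b h : S → ℝ} {H : ℝ} (hab : ∑ y, a y = ∑ y, b y)
    (h0 : ∀ y, 0 ≤ h y) (hH : ∀ y, h y ≤ H) : ∑ y, (a y - b y) * h y ≤ tvDist a b * H := by
  have h1 : ∑ y, (a y - b y) * h y = ∑ y, (a y - b y) * (h y - H / 2) := by
    simp only [mul_sub, Finset.sum_sub_distrib, ← Finset.sum_mul, hab]
    ring
  rw [h1, tvDist, mul_comm (1 / 2 : ℝ), mul_assoc, Finset.sum_mul]
  refine Finset.sum_le_sum fun y _ => ?_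
  refine (le_abs_self _).trans ?_
  rw [abs_mul]
  refine mul_le_mul_of_nonneg_left ?_ (abs_nonneg _)
  rw [abs_le]
  constructor <;> linarith [h0 y, hH y]

open Matrix
open scoped Matrix.Norms.Operator

variable {S : Type*} [Fintype S] [DecidableEq S] {Q : Matrix S S ℝ} {K : Set S} {h : S → ℝ}

lemma survival_eq_sum_exp (Q : Matrix S S ℝ) {x : S} (hx : x ∉ K) (t : ℝ) :
    survival Q K t x = ∑ y, NormedSpace.exp (t • killed Q K) x y := by
  simp only [survival, Matrix.mulVec, dotProduct]
  refine Finset.sum_congr rfl fun y _ => ?_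
  by_cases hy : y ∈ K
  · have hxy : x ≠ y := by rintro rfl; exact hx hy
    simp [hy, exp_killed_apply_of_mem_right Q hy, Matrix.one_apply_ne hxy]
  · simp [hy]

/-- If the initial law `p` is nearly preserved up to time `T`, then `T` is small compared to the
maximal mean hitting time. -/
lemma IsMeanTime.mul_le_of_slow_escape (hQ : IsRateMatrix Q) (hh : IsMeanTime Q K h) {p : S → ℝ}
    {T H f : ℝ} (hT : 0 ≤ T) (hp0 : ∀ x, 0 ≤ p x) (hp1 : ∑ x, p x = 1) (hpK : ∀ x ∈ K, p x = 0)
    (hsub : ∀ y, ∑ x, p x * NormedSpace.exp (T • killed Q K) x y ≤ p y) (hH0 : 0 ≤ H)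
    (hH : ∀ x, h x ≤ H) (hf : 1 - f ≤ ∑ x, p x * survival Q K T x) : T * (1 - f) ≤ f * H := by
  set g := ∑ x, p x * survival Q K T x with hg
  have h1 : T * g ≤ ∑ x, p x * (h x - (NormedSpace.exp (T • killed Q K) *ᵥ h) x) := by
    rw [hg, Finset.mul_sum]
    refine Finset.sum_le_sum fun x _ => ?_
    rw [mul_left_comm]
    exact mul_le_mul_of_nonneg_left (hh.mul_survival_le hQ hT x) (hp0 x)
  -- Moving the semigroup onto `p`: the deficit `p - p exp (T L)` is non-negative with total mass `1
  -- - g`, so its pairing with `h` is at most `(1 - g) H`, while the left side dominates `T g`.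
  have h2 : ∑ x, p x * (h x - (NormedSpace.exp (T • killed Q K) *ᵥ h) x) =
      ∑ y, (p y - ∑ x, p x * NormedSpace.exp (T • killed Q K) x y) * h y := by
    simp only [mul_sub, sub_mul, Finset.sum_sub_distrib, Matrix.mulVec, dotProduct,
      Finset.mul_sum, Finset.sum_mul, mul_assoc]
    rw [Finset.sum_comm (γ := S)]
  have h3 : g = ∑ y, ∑ x, p x * NormedSpace.exp (T • killed Q K) x y := by
    rw [hg, Finset.sum_comm]
    refine Finset.sum_congr rfl fun x _ => ?_
    by_cases hx : x ∈ K
    · simp [hpK x hx]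
    · rw [survival_eq_sum_exp Q hx, Finset.mul_sum]
  have h4 : ∑ y, (p y - ∑ x, p x * NormedSpace.exp (T • killed Q K) x y) * h y ≤ (1 - g) * H := by
    rw [h3, ← hp1, ← Finset.sum_sub_distrib, Finset.sum_mul]
    exact Finset.sum_le_sum fun y _ => mul_le_mul_of_nonneg_left (hH y) (sub_nonneg.2 (hsub y))
  have h5 := mul_le_mul_of_nonneg_left hf hT
  have h6 : (1 - g) * H ≤ f * H := mul_le_mul_of_nonneg_right (by linarith) hH0
  linarith

/-- The mean hitting times from two points which are unlikely to reach `K` before they mix. -/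
lemma IsMeanTime.sub_le_of_mixing (hQ : IsRateMatrix Q) (hh : IsMeanTime Q K h) {R H ε d : ℝ}
    (hR : 0 ≤ R) (hH : ∀ x, h x ≤ H) {x x' : S} (hx : x ∉ K) (hx' : x' ∉ K)
    (hle : ∀ x y, x ∉ K → y ∉ K →
      NormedSpace.exp (R • killed Q K) x y ≤ NormedSpace.exp (R • Q) x y)
    (hsurv : 1 - survival Q K R x' ≤ ε)
    (htv : tvDist (NormedSpace.exp (R • Q) x) (NormedSpace.exp (R • Q) x') ≤ d) :
    h x - h x' ≤ R + (ε + d) * H := by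
  have hnn := hh.nonneg hQ
  have hH0 : 0 ≤ H := (hnn x).trans (hH x)
  have h1 := hh.sub_le hQ hR x
  have h2 := hh.mul_survival_le hQ hR x'
  have h3 := mul_nonneg hR (hQ.survival_nonneg K hR x')
  -- Chain of comparisons: run the killed chain from `x` for time `R`, drop the killing, pass from
  -- `x` to `x'` at cost `d H`, and restore the killing at cost `ε H`.
  have h4 : (NormedSpace.exp (R • killed Q K) *ᵥ h) x ≤ (NormedSpace.exp (R • Q) *ᵥ h) x := by
    refine Finset.sum_le_sum fun y _ => ?_
    by_cases hy : y ∈ K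
    · simp [hh.eq_zero y hy]
    · exact mul_le_mul_of_nonneg_right (hle x y hx hy) (hnn y)
  have h5 : (NormedSpace.exp (R • Q) *ᵥ h) x' - (NormedSpace.exp (R • killed Q K) *ᵥ h) x' ≤
      ε * H := by
    refine le_trans ?_ (mul_le_mul_of_nonneg_right hsurv hH0)
    rw [survival_eq_sum_exp Q hx', ← hQ.sum_exp_eq_one R x', ← Finset.sum_sub_distrib,
      Finset.sum_mul]
    simp only [Matrix.mulVec, dotProduct]
    rw [← Finset.sum_sub_distrib]
    refine Finset.sum_le_sum fun y _ => ?_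
    rw [← sub_mul]
    by_cases hy : y ∈ K
    · have hxy : x' ≠ y := by rintro rfl; exact hx' hy
      rw [hh.eq_zero y hy, mul_zero, exp_killed_apply_of_mem_right Q hy, Matrix.one_apply_ne hxy,
        sub_zero]
      exact mul_nonneg (hQ.isMetzler.exp_nonneg hR x' y) hH0
    · exact mul_le_mul_of_nonneg_left (hH y) (sub_nonneg.2 (hle x' y hx' hy))
  have h6 : (NormedSpace.exp (R • Q) *ᵥ h) x - (NormedSpace.exp (R • Q) *ᵥ h) x' ≤ d * H := by
    refine le_trans ?_ (mul_le_mul_of_nonneg_right htv hH0)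
    refine le_trans (le_of_eq ?_) (sum_sub_mul_le_tvDist
      ((hQ.sum_exp_eq_one R x).trans (hQ.sum_exp_eq_one R x').symm) hnn hH)
    simp only [Matrix.mulVec, dotProduct, sub_mul, Finset.sum_sub_distrib]
  linarith

/-- Survival from `B` decays at most geometrically, since the chain returns to `B` quickly. -/
lemma IsRateMatrix.pow_le_survival (hQ : IsRateMatrix Q) {B : Set S} (hB : ∀ x ∈ B, x ∉ K)
    {R ε r : ℝ} (hR : 0 ≤ R) (hr0 : 0 ≤ r) (hsurv : ∀ x ∈ B, 1 - survival Q K (2 * R) x ≤ ε)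
    (hrec : ∀ x, survival Q (B ∪ K) R x ≤ r) (hq : 0 ≤ 1 - ε - r) (k : ℕ) :
    ∀ x ∈ B, (1 - ε - r) ^ k ≤ survival Q K (k * R) x := by
  induction k with
  | zero =>
    intro x hx
    simp [survival_zero, hB x hx]
  | succ k ih =>
    intro x hx
    have hkR : 0 ≤ k * R := by positivity
    have hE := (hQ.isMetzler_killed K).exp_nonneg hR
    -- From `y`, the chain survives a time `R` and meets `B` meanwhile with probability at least
    -- `survival Q K R y - r`; the induction hypothesis takes over from `B`. Averaging over the
    -- position `y` at time `R` produces survival up to `2 * R` from `x`, which is why `hsurv` is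
    -- stated on that horizon.
    have h1 : ∀ y, (1 - ε - r) ^ k * (survival Q K R y - r) ≤ survival Q K (k * R) y := by
      intro y
      refine le_trans (mul_le_mul_of_nonneg_left ?_ (pow_nonneg hq k)) (hQ.superharmonic_ge B
        (pow_nonneg hq k) hR (hQ.survival_nonneg K hkR) (hQ.deriv_survival_nonpos K hkR)
        (fun z hz _ => ih z hz) y)
      linarith [hrec y]
    have h2 := Matrix.mulVec_mono hE h1 x
    have h3 : ((k + 1 : ℕ) : ℝ) * R = R + k * R := by push_cast; ring
    rw [h3, survival_add]
    refine le_trans ?_ h2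
    have h4 : (NormedSpace.exp (R • killed Q K) *ᵥ
        fun y => (1 - ε - r) ^ k * (survival Q K R y - r)) x =
        (1 - ε - r) ^ k * (survival Q K (2 * R) x - r * survival Q K R x) := by
      rw [two_mul, survival_add, survival_eq_sum_exp Q (hB x hx)]
      simp only [Matrix.mulVec, dotProduct, Finset.mul_sum]
      rw [← Finset.sum_sub_distrib, Finset.mul_sum]
      exact Finset.sum_congr rfl fun y _ => by ring
    rw [h4, pow_succ]
    refine mul_le_mul_of_nonneg_left ?_ (pow_nonneg hq k)
    have h5 := mul_le_of_le_one_right hr0 (hQ.survival_le_one K hR x)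
    linarith [hsurv x hx]

/-- If the row sums of the exponential decay at most like `q ^ k`, then so does the limiting
eigenvector. -/
lemma Matrix.le_exp_eigenvalue {L : Matrix S S ℝ} {ν : S → ℝ} {s R q : ℝ} {x : S} (hR : 0 < R)
    (hq : 0 < q) (hν1 : ∑ y, ν y = 1) (hνL : ν ᵥ* L = s • ν)
    (hlim : ∀ y, Tendsto (fun t : ℝ => NormedSpace.exp (t • L) x y /
      ∑ z, NormedSpace.exp (t • L) x z) atTop (𝓝 (ν y)))
    (hlow : ∀ k : ℕ, q ^ k ≤ ∑ z, NormedSpace.exp (((k : ℝ) * R) • L) x z) :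
    q ≤ Real.exp (s * R) := by
  by_contra! hlt
  set Z : ℕ → ℝ := fun k => ∑ z, NormedSpace.exp (((k : ℝ) * R) • L) x z with hZ
  have hZpos : ∀ k, 0 < Z k := fun k => (pow_pos hq k).trans_le (hlow k)
  -- Since the normalized row tends to `ν`, one more step of length `R` multiplies the mass
  -- asymptotically by `exp (s * R)`. Were this below `q`, the ratio test would give `Z k / q ^ k →
  -- 0`, although these quotients are at least `1`.
  have hratio : Tendsto (fun k => Z (k + 1) / Z k) atTop (𝓝 (Real.exp (s * R))) := by
    have h1 : Tendsto (fun k : ℕ => (k : ℝ) * R) atTop atTop :=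
      tendsto_natCast_atTop_atTop.atTop_mul_const hR
    have h2 := tendsto_finsetSum Finset.univ fun y _ =>
      ((hlim y).comp h1).mul_const (∑ z, NormedSpace.exp (R • L) y z)
    have h3 : ∑ y, ν y * ∑ z, NormedSpace.exp (R • L) y z = Real.exp (s * R) := by
      simp only [Finset.mul_sum]
      rw [Finset.sum_comm]
      have h4 : ∀ z, ∑ y, ν y * NormedSpace.exp (R • L) y z = Real.exp (s * R) * ν z :=
        fun z => Matrix.vecMul_exp_of_eigen hνL R z
      simp only [h4, ← Finset.mul_sum, hν1, mul_one]
    rw [h3] at h2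
    refine h2.congr fun k => ?_
    have h5 : ((k + 1 : ℕ) : ℝ) * R = k * R + R := by push_cast; ring
    simp only [hZ, h5, Matrix.exp_add_smul, Matrix.mul_apply, Function.comp_apply, Finset.mul_sum,
      Finset.sum_div]
    rw [Finset.sum_comm]
    exact Finset.sum_congr rfl fun z _ => Finset.sum_congr rfl fun y _ => by ring
  have hsum : Summable fun k => Z k / q ^ k := by
    refine summable_of_ratio_test_tendsto_lt_one ((div_lt_one hq).2 hlt)
      (Eventually.of_forall fun k => (div_pos (hZpos k) (pow_pos hq k)).ne')
      ((hratio.div_const q).congr fun k => ?_)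
    rw [Real.norm_of_nonneg (div_pos (hZpos _) (pow_pos hq _)).le,
      Real.norm_of_nonneg (div_pos (hZpos _) (pow_pos hq _)).le, pow_succ]
    have := (hZpos k).ne'
    field_simp
  have h1 := hsum.tendsto_atTop_zero
  have h2 : (1 : ℝ) ≤ 0 := ge_of_tendsto' h1 fun k => by
    rw [one_le_div (pow_pos hq k)]; exact hlow k
  linarith

/-- The mean hitting time from a quasi-stationary law with slow decay is at least almost the
minimum over `B`. -/
lemma IsMeanTime.le_sum_of_eigenvector (hQ : IsRateMatrix Q) (hh : IsMeanTime Q K h) (B : Set S)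
    {ν : S → ℝ} {s R q r m : ℝ} (hR : 0 ≤ R) (hν0 : ∀ y, 0 ≤ ν y) (hν1 : ∑ y, ν y = 1)
    (hνK : ∀ y ∈ K, ν y = 0) (hνL : ν ᵥ* killed Q K = s • ν) (hq : q ≤ Real.exp (s * R))
    (hrec : ∀ x, survival Q (B ∪ K) R x ≤ r) (hm0 : 0 ≤ m) (hm : ∀ x ∈ B, m ≤ h x) :
    (q - r) * m ≤ ∑ y, ν y * h y := by
  have h1 : ∑ y, ν y * survival Q K R y = Real.exp (s * R) := by
    have h2 : ∀ z, ∑ y, ν y * NormedSpace.exp (R • killed Q K) y z = Real.exp (s * R) * ν z :=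
      fun z => Matrix.vecMul_exp_of_eigen hνL R z
    have h3 : ∀ y, ν y * survival Q K R y =
        ∑ z, ν y * NormedSpace.exp (R • killed Q K) y z := by
      intro y
      by_cases hy : y ∈ K
      · simp [hνK y hy]
      · rw [survival_eq_sum_exp Q hy, Finset.mul_sum]
    simp only [h3]
    rw [Finset.sum_comm]
    simp only [h2, ← Finset.mul_sum, hν1, mul_one]
  -- The function `h` is itself superharmonic, and from `y` the chain reaches `B` before `K` with
  -- probability at least `survival Q K R y - r`; the `ν`-mean of survival is `exp (s * R)`.
  have h2 : ∀ y, ν y * (m * (survival Q K R y - r)) ≤ ν y * h y := by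
    intro y
    refine mul_le_mul_of_nonneg_left (le_trans (mul_le_mul_of_nonneg_left ?_ hm0)
      (hQ.superharmonic_ge (K := K) B hm0 hR (hh.nonneg hQ) (fun x => ?_) (fun x hx _ => hm x hx) y)) (hν0 y)
    · linarith [hrec y]
    · rw [hh.generator x]
      exact neg_nonpos.2 (Set.indicator_nonneg (fun _ _ => zero_le_one) x)
  refine le_trans ?_ (Finset.sum_le_sum fun y _ => h2 y)
  have h3 : ∑ y, ν y * (m * (survival Q K R y - r)) = m * (Real.exp (s * R) - r) := by
    have h4 : ∀ y, ν y * (m * (survival Q K R y - r)) =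
        m * (ν y * survival Q K R y) - m * r * ν y := fun y => by ring
    simp only [h4, Finset.sum_sub_distrib, ← Finset.mul_sum, h1, hν1]
    ring
  rw [h3, mul_comm]
  exact mul_le_mul_of_nonneg_left (by linarith) hm0

end Estimates

/-! ### The basin, the quasi-stationary measure and the uniform bounds. -/

namespace TrappedChain

open scoped Matrix.Norms.Operator

variable {S Ω : Type*} [Fintype S] [DecidableEq S] [MeasurableSpace Ω] (M : TrappedChain S Ω)

lemma stat_pos (x : S) : 0 < M.stat x := M.invariant.pos M.rate M.irreducible x

lemma sum_indicator_pos : 0 < ∑ z, M.A.indicator M.stat z := by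
  obtain ⟨a, ha⟩ := M.A_nonempty
  have hnn : ∀ z ∈ Finset.univ, 0 ≤ M.A.indicator M.stat z := fun z _ =>
    Set.indicator_nonneg (fun y _ => (M.stat_pos y).le) z
  refine lt_of_lt_of_le ?_ (Finset.single_le_sum hnn (Finset.mem_univ a))
  rw [Set.indicator_of_mem ha]
  exact M.stat_pos a

lemma restricted_nonneg (x : S) : 0 ≤ M.restricted x :=
  div_nonneg (Set.indicator_nonneg (fun y _ => (M.stat_pos y).le) x) M.sum_indicator_pos.le

lemma sum_restricted : ∑ x, M.restricted x = 1 := by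
  simp only [restricted, ← Finset.sum_div]
  exact div_self M.sum_indicator_pos.ne'

lemma restricted_of_mem_G {x : S} (hx : x ∈ M.G) : M.restricted x = 0 := by
  rw [restricted, Set.indicator_of_notMem hx, zero_div]

lemma exists_isMeanTime : ∃ h, IsMeanTime M.Q M.G h :=
  M.rate.exists_isMeanTime M.irreducible M.compl_nonempty

lemma exp_killed_le (t : ℝ≥0) {x y : S} (hx : x ∉ M.G) :
    NormedSpace.exp ((t : ℝ) • killed M.Q M.G) x y ≤ NormedSpace.exp ((t : ℝ) • M.Q) x y := by
  have := M.prob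
  rw [← (M.chain x).measureReal_eq_and_lt_hittingTime M.rate hx,
    ← (M.chain x).measureReal_eq M.rate]
  exact measureReal_mono fun ω hω => hω.1

/-- Killing only lowers transition probabilities, and the full invariant measure dominates its
restriction to `A`. Subinvariance is what `IsMeanTime.mul_le_of_slow_escape` requires. -/
lemma sum_restricted_mul_exp_le (t : ℝ≥0) (y : S) :
    ∑ x, M.restricted x * NormedSpace.exp ((t : ℝ) • killed M.Q M.G) x y ≤ M.restricted y := by
  have hQ := M.rate
  by_cases hy : y ∈ M.G
  · rw [M.restricted_of_mem_G hy]
    refine (Finset.sum_eq_zero fun x _ => ?_).le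
    by_cases hx : x ∈ M.G
    · rw [M.restricted_of_mem_G hx, zero_mul]
    · have hxy : x ≠ y := by rintro rfl; exact hx hy
      rw [exp_killed_apply_of_mem_right _ hy, Matrix.one_apply_ne hxy, mul_zero]
  · have hyA : y ∈ M.A := not_not.1 hy
    simp only [restricted, div_mul_eq_mul_div, ← Finset.sum_div]
    rw [Set.indicator_of_mem hyA]
    refine div_le_div_of_nonneg_right ?_ M.sum_indicator_pos.le
    rw [← M.invariant.sum_mul_exp t y]
    refine Finset.sum_le_sum fun x _ => ?_
    have h0 := M.stat_pos x
    by_cases hx : x ∈ M.A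
    · rw [Set.indicator_of_mem hx]
      exact mul_le_mul_of_nonneg_left (M.exp_killed_le t (not_not.2 hx)) h0.le
    · rw [Set.indicator_of_notMem hx, zero_mul]
      exact mul_nonneg h0.le (hQ.isMetzler.exp_nonneg t.2 x y)

lemma escapeProb_eq (t : ℝ≥0) :
    M.escapeProb t = ∑ x, M.restricted x * (1 - survival M.Q M.G t x) := by
  have := M.prob
  exact Finset.sum_congr rfl fun x _ => by
    rw [(M.chain x).measureReal_hittingTime_le M.rate]

lemma escapeProb_eq_reversed (t : ℝ≥0) : M.escapeProb t =
    ∑ x, M.restricted x * (1 - survival (reversedRate M.Q M.stat) M.G t x) := by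
  have h : ∀ Q : Matrix S S ℝ, ∑ x, M.restricted x * (1 - survival Q M.G t x) =
      1 - (∑ x, M.stat x * survival Q M.G t x) / ∑ z, M.A.indicator M.stat z := by
    intro Q
    simp only [mul_sub, mul_one, Finset.sum_sub_distrib, M.sum_restricted, Finset.sum_div]
    congr 1
    refine Finset.sum_congr rfl fun x _ => ?_
    by_cases hx : x ∈ M.G
    · rw [survival_of_mem _ hx, mul_zero, mul_zero, zero_div]
    · rw [restricted, Set.indicator_of_mem (not_not.1 hx), div_mul_eq_mul_div]
  rw [M.escapeProb_eq, h, h, sum_mul_survival_reversedRate M.stat_pos]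

lemma mem_basin_iff (R : ℝ≥0) (f α : ℝ) (x : S) : x ∈ M.basin R f α ↔ x ∈ M.A ∧
    1 / 2 * ((1 - survival M.Q M.G (2 * R) x) +
      (1 - survival (reversedRate M.Q M.stat) M.G (2 * R) x)) ≤ f ^ α := by
  have := M.prob
  have h1 := (M.chain x).measureReal_hittingTime_le M.rate M.G (2 * R)
  have h2 := (M.chain_rev x).measureReal_hittingTime_le
    (M.invariant.isRateMatrix_reversedRate M.rate) M.G (2 * R)
  rw [NNReal.coe_mul, NNReal.coe_ofNat] at h1 h2
  rw [← h1, ← h2]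
  rfl

lemma notMem_G_of_mem_basin {R : ℝ≥0} {f α : ℝ} {x : S} (hx : x ∈ M.basin R f α) : x ∉ M.G :=
  not_not.2 hx.1

lemma one_sub_survival_le_of_mem_basin {R : ℝ≥0} {f α : ℝ} {x : S} (hx : x ∈ M.basin R f α) :
    1 - survival M.Q M.G (2 * R) x ≤ 2 * f ^ α := by
  have h1 := ((M.mem_basin_iff R f α x).1 hx).2
  have h2 := (M.invariant.isRateMatrix_reversedRate M.rate).survival_le_one M.G
    (t := 2 * R) (by positivity) x
  linarith

/-- Under slow escape the basin carries almost all of `π_A`. -/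
lemma le_sum_restricted_basin {R : ℝ≥0} {f α : ℝ} (hf : 0 < f) (hs : M.SlowEscape R f) :
    1 - f ^ (1 - α) ≤ ∑ x, (M.basin R f α).indicator M.restricted x := by
  have hfα : 0 < f ^ α := Real.rpow_pos_of_pos hf α
  -- Markov's inequality: on `A` outside the basin the averaged escape probability exceeds `f ^ α`,
  -- while its `π_A`-mean is at most `f`.
  have h1 : ∀ x, f ^ α * (M.restricted x - (M.basin R f α).indicator M.restricted x) ≤
      M.restricted x * (1 / 2 * ((1 - survival M.Q M.G (2 * R) x) +
        (1 - survival (reversedRate M.Q M.stat) M.G (2 * R) x))) := by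
    intro x
    have h2 := M.rate.survival_le_one M.G (t := 2 * R) (by positivity) x
    have h3 := (M.invariant.isRateMatrix_reversedRate M.rate).survival_le_one M.G
      (t := 2 * R) (by positivity) x
    by_cases hx : x ∈ M.basin R f α
    · rw [Set.indicator_of_mem hx, sub_self, mul_zero]
      exact mul_nonneg (M.restricted_nonneg x) (by linarith)
    · rw [Set.indicator_of_notMem hx, sub_zero, mul_comm]
      by_cases hG : x ∈ M.G
      · rw [M.restricted_of_mem_G hG, zero_mul, zero_mul]
      · refine mul_le_mul_of_nonneg_left ?_ (M.restricted_nonneg x)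
        by_contra! hlt
        exact hx ((M.mem_basin_iff R f α x).2 ⟨not_not.1 hG, hlt.le⟩)
  have h4 := Finset.sum_le_sum fun x (_ : x ∈ Finset.univ) => h1 x
  have h5 : ∑ x, M.restricted x * (1 / 2 * ((1 - survival M.Q M.G (2 * R) x) +
      (1 - survival (reversedRate M.Q M.stat) M.G (2 * R) x))) = M.escapeProb (2 * R) := by
    have h6 := M.escapeProb_eq (2 * R)
    have h7 := M.escapeProb_eq_reversed (2 * R)
    rw [NNReal.coe_mul, NNReal.coe_ofNat] at h6 h7
    have h8 : ∀ a b c : ℝ, a * (1 / 2 * (b + c)) = 1 / 2 * (a * b) + 1 / 2 * (a * c) :=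
      fun a b c => by ring
    simp only [h8, Finset.sum_add_distrib, ← Finset.mul_sum, ← h6, ← h7]
    ring
  rw [h5, ← Finset.mul_sum, Finset.sum_sub_distrib, M.sum_restricted] at h4
  have h9 : f ^ α * (1 - ∑ x, (M.basin R f α).indicator M.restricted x) ≤ f ^ α * f ^ (1 - α) := by
    rw [← Real.rpow_add hf, add_sub_cancel, Real.rpow_one]
    exact h4.trans hs
  have := le_of_mul_le_mul_left h9 hfα
  linarith

lemma conditioned_eq {x : S} (hx : x ∉ M.G) (t : ℝ≥0) (y : S) : M.conditioned x t y =
    NormedSpace.exp ((t : ℝ) • killed M.Q M.G) x y /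
      ∑ z, NormedSpace.exp ((t : ℝ) • killed M.Q M.G) x z := by
  have := M.prob
  rw [conditioned, (M.chain x).measureReal_eq_and_lt_hittingTime M.rate hx,
    (M.chain x).measureReal_lt_hittingTime M.rate, survival_eq_sum_exp _ hx]

lemma tendsto_conditionedFrom {ν : S → S → ℝ}
    (hν : ∀ x y, Tendsto (fun t : ℝ => NormedSpace.exp (t • killed M.Q M.G) x y /
      ∑ z, NormedSpace.exp (t • killed M.Q M.G) x z) atTop (𝓝 (ν x y))) (y : S) :
    Tendsto (fun t : ℝ≥0 => M.conditionedFrom M.restricted t y) atTop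
      (𝓝 (∑ x, M.restricted x * ν x y)) := by
  refine tendsto_finsetSum _ fun x _ => ?_
  by_cases hx : x ∈ M.G
  · simp [M.restricted_of_mem_G hx]
  · refine Tendsto.const_mul _ ?_
    refine ((hν x y).comp (NNReal.tendsto_coe_atTop.2 tendsto_id)).congr fun t => ?_
    rw [M.conditioned_eq hx]
    rfl

lemma quasiStationary_eq {ν : S → S → ℝ}
    (hν : ∀ x y, Tendsto (fun t : ℝ => NormedSpace.exp (t • killed M.Q M.G) x y /
      ∑ z, NormedSpace.exp (t • killed M.Q M.G) x z) atTop (𝓝 (ν x y))) (y : S) :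
    M.quasiStationary y = ∑ x, M.restricted x * ν x y :=
  (M.tendsto_conditionedFrom hν y).limUnder_eq

lemma tendsto_quasiStationary (y : S) :
    Tendsto (fun t : ℝ≥0 => M.conditionedFrom M.restricted t y) atTop
      (𝓝 (M.quasiStationary y)) := by
  choose ν s _ _ _ hν using
    fun x : S => (M.rate.isMetzler_killed M.G).exists_tendsto_normalized_row x
  rw [M.quasiStationary_eq hν]
  exact M.tendsto_conditionedFrom hν y

lemma meanExit_eq {h : S → ℝ} (hh : IsMeanTime M.Q M.G h) (x : S) :
    M.meanExit x = ENNReal.ofReal (h x) := by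
  have := M.prob
  exact (M.chain x).lintegral_hittingTime M.rate hh

lemma meanExitFrom_eq {h : S → ℝ} (hh : IsMeanTime M.Q M.G h) {ν : S → ℝ} (hν : ∀ x, 0 ≤ ν x) :
    M.meanExitFrom ν = ENNReal.ofReal (∑ x, ν x * h x) := by
  rw [meanExitFrom, ENNReal.ofReal_sum_of_nonneg fun x _ => mul_nonneg (hν x) (hh.nonneg M.rate x)]
  exact Finset.sum_congr rfl fun x _ => by
    rw [M.meanExit_eq hh, ENNReal.ofReal_mul (hν x)]

/-- The relative error in the comparison of the mean exit times from the basin. -/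
noncomputable def basinError (d f r α : ℝ) : ℝ := f / (2 * (1 - f)) * (1 / (1 - r) + 1) + 2 * f ^ α + d

/-- A lower bound for the ratios of the mean exit times to their maximum. -/
noncomputable def exitFraction (d f r α : ℝ) : ℝ :=
  (1 - f ^ (1 - α)) * ((1 - 2 * f ^ α - 2 * r) * (1 - basinError d f r α))

lemma tendsto_exitFraction {d f r : ℕ → ℝ} {α : ℝ} (hα : α ∈ Set.Ioo (0 : ℝ) 1)
    (hd : Tendsto d atTop (𝓝 0)) (hf : Tendsto f atTop (𝓝 0)) (hr : Tendsto r atTop (𝓝 0)) :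
    Tendsto (fun n => basinError (d n) (f n) (r n) α) atTop (𝓝 0) ∧
    Tendsto (fun n => 1 - 2 * f n ^ α - 2 * r n) atTop (𝓝 1) ∧
    Tendsto (fun n => exitFraction (d n) (f n) (r n) α) atTop (𝓝 1) := by
  have h1 : Tendsto (fun n => f n ^ α) atTop (𝓝 0) := by
    have := hf.rpow_const (p := α) (Or.inr hα.1.le)
    rwa [Real.zero_rpow hα.1.ne'] at this
  have h2 : Tendsto (fun n => f n ^ (1 - α)) atTop (𝓝 0) := by
    have := hf.rpow_const (p := 1 - α) (Or.inr (by linarith [hα.2]))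
    rwa [Real.zero_rpow (by linarith [hα.2])] at this
  have h3 : Tendsto (fun n => basinError (d n) (f n) (r n) α) atTop (𝓝 0) := by
    have ha := hf.div ((hf.const_sub 1).const_mul 2) (by norm_num)
    have hb := ((hr.const_sub 1).inv₀ (by norm_num)).add_const 1
    have := ((ha.mul hb).add (h1.const_mul 2)).add hd
    simp only [mul_zero, add_zero, zero_div, zero_mul] at this
    simpa only [basinError, one_div, Pi.div_apply] using this
  have h4 : Tendsto (fun n => 1 - 2 * f n ^ α - 2 * r n) atTop (𝓝 1) := by
    simpa using ((h1.const_mul 2).const_sub 1).sub (hr.const_mul 2)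
  refine ⟨h3, h4, ?_⟩
  simpa [exitFraction] using (h2.const_sub 1).mul (h4.mul (h3.const_sub 1))

variable {M}

/-- Mean exit times from the basin, from `π_A` and from `μ*_A` are all close to their maximum. -/
theorem HpG.exists_max_bounds {R : ℝ≥0} {d f r α : ℝ} (hM : M.HpG R d f r α)
    (hα : α ∈ Set.Ioo (0 : ℝ) 1) (hδ : basinError d f r α < 1) (hq : 0 < 1 - 2 * f ^ α - 2 * r)
    {h : S → ℝ} (hh : IsMeanTime M.Q M.G h) :
    ∃ H, 0 < H ∧
      (∀ x ∈ M.basin R f α, exitFraction d f r α * H ≤ h x ∧ h x ≤ H) ∧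
      (exitFraction d f r α * H ≤ ∑ x, M.restricted x * h x ∧
        ∑ x, M.restricted x * h x ≤ H) ∧
      (∀ x, 0 ≤ M.quasiStationary x) ∧
      (exitFraction d f r α * H ≤ ∑ x, M.quasiStationary x * h x ∧
        ∑ x, M.quasiStationary x * h x ≤ H) := by
  have hprob := M.prob
  have hQ := M.rate
  have hR : (1 : ℝ) < R := by exact_mod_cast hM.one_lt_R
  have hR0 : (0 : ℝ) ≤ R := R.2
  obtain ⟨hf0, hf1⟩ := hM.f_mem
  obtain ⟨hr0, hr1⟩ := hM.r_mem
  have hd0 := hM.d_mem.1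
  set B := M.basin R f α with hB
  set δ := basinError d f r α with hδdef
  have hε0 : 0 < f ^ α := Real.rpow_pos_of_pos hf0 α
  have hβ0 : 0 < f ^ (1 - α) := Real.rpow_pos_of_pos hf0 _
  have hβ1 : f ^ (1 - α) < 1 := Real.rpow_lt_one hf0.le hf1 (by linarith [hα.2])
  have hδ0 : 0 ≤ δ := by
    have h1 : 0 < 1 - f := by linarith
    have h2 : 0 < 1 - r := by linarith
    rw [hδdef, basinError]
    positivity
  have hnn := hh.nonneg hQ
  have hmass := M.le_sum_restricted_basin (α := α) hf0 hM.slow_escape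
  have hrec : ∀ x, survival M.Q (B ∪ M.G) R x ≤ r := fun x => by
    rw [← (M.chain x).measureReal_lt_hittingTime hQ]
    exact (hM.fast_recurrence x).le
  -- the maximum of the mean exit times
  obtain ⟨a, ha⟩ := M.A_nonempty
  have hne : Nonempty S := ⟨a⟩
  obtain ⟨x₁, hx₁⟩ := Finite.exists_max h
  set H := h x₁ with hHdef
  have hH0 : 0 ≤ H := hnn x₁
  -- it is large compared to `R`
  have hRH : 2 * R * (1 - f) ≤ f * H := by
    have h1 := M.sum_restricted_mul_exp_le (2 * R)
    have h2 := M.escapeProb_eq (2 * R)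
    rw [NNReal.coe_mul, NNReal.coe_ofNat] at h1 h2
    refine hh.mul_le_of_slow_escape hQ (by positivity) M.restricted_nonneg M.sum_restricted
      (fun x hx => M.restricted_of_mem_G hx) h1 hH0 hx₁ ?_
    have h3 := hM.slow_escape
    rw [SlowEscape, h2] at h3
    simp only [mul_sub, mul_one, Finset.sum_sub_distrib, M.sum_restricted] at h3
    linarith
  have hHpos : 0 < H := by
    by_contra! hle
    have h1 : 0 < 2 * (R : ℝ) * (1 - f) := by
      have : 0 < 1 - f := by linarith
      positivity
    nlinarith
  have hRH' : R ≤ f / (2 * (1 - f)) * H := by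
    have h1 : 0 < 2 * (1 - f) := by linarith
    rw [div_mul_eq_mul_div, le_div_iff₀ h1]
    linarith
  -- the basin is non-empty, and the mean exit time oscillates little on it
  have hBne : B.Nonempty := by
    by_contra hemp
    rw [Set.not_nonempty_iff_eq_empty] at hemp
    rw [← hB, hemp] at hmass
    simp only [Set.indicator_empty, Finset.sum_const_zero] at hmass
    linarith
  obtain ⟨x₂, hx₂B, hx₂⟩ := B.toFinite.exists_maximalFor h B hBne
  have hx₂max : ∀ x ∈ B, h x ≤ h x₂ := fun x hx => by
    rcases le_total (h x) (h x₂) with h1 | h1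
    · exact h1
    · exact hx₂ hx h1
  have hBG : ∀ x ∈ B, x ∉ M.G := fun x hx => M.notMem_G_of_mem_basin hx
  have hsurv2 : ∀ x ∈ B, 1 - survival M.Q M.G (2 * R) x ≤ 2 * f ^ α :=
    fun x hx => M.one_sub_survival_le_of_mem_basin hx
  have hsurv : ∀ x ∈ B, 1 - survival M.Q M.G R x ≤ 2 * f ^ α := fun x hx => by
    have := hQ.survival_antitone M.G hR0 (by linarith : (R : ℝ) ≤ 2 * R) x
    linarith [hsurv2 x hx]
  have hbasin : ∀ x ∈ B, (1 - δ) * H ≤ h x := by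
    intro x hx
    -- The factor `2` in `2 * f ^ α` arises because the basin bounds the half-sum of the forward and
    -- backward escape probabilities, so the forward one alone may be twice as large.
    have h1 : h x₂ - h x ≤ R + (2 * f ^ α + d) * H := by
      refine hh.sub_le_of_mixing hQ hR0 hx₁ (hBG x₂ hx₂B) (hBG x hx)
        (fun x y hx _ => M.exp_killed_le R hx) (hsurv x hx) ?_
      have h2 := hM.fast_thermalization x₂ hx₂B x hx
      have h3 : ∀ z, M.evolved z R = NormedSpace.exp ((R : ℝ) • M.Q) z := fun z => by
        ext y
        exact (M.chain z).measureReal_eq hQ y R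
      rwa [h3, h3] at h2
    have h4 := hh.le_of_recurrence hQ B hR0 (hnn x₂) (hx₁ x₂) hx₂max hx₁ (hrec x₁) hr0.le
    -- The recurrence bound at the maximizer reads `H ≤ h x₂ + R + r * (H - h x₂)`; solving for `H -
    -- h x₂` gives the factor `1 / (1 - r)`.
    have h5 : H - h x₂ ≤ R * (1 / (1 - r)) := by
      rw [mul_one_div, le_div_iff₀ (by linarith)]
      linarith
    have h6 : (R : ℝ) * (1 / (1 - r) + 1) ≤ f / (2 * (1 - f)) * H * (1 / (1 - r) + 1) := by
      refine mul_le_mul_of_nonneg_right hRH' ?_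
      have : 0 < 1 - r := by linarith
      positivity
    have h7 : δ * H = f / (2 * (1 - f)) * H * (1 / (1 - r) + 1) + (2 * f ^ α + d) * H := by
      rw [hδdef, basinError]; ring
    linarith
  -- the constants
  have hδ1 : 0 < 1 - δ := by linarith
  have hq1 : 1 - 2 * f ^ α - 2 * r ≤ 1 := by linarith
  have hη : exitFraction d f r α = (1 - f ^ (1 - α)) * ((1 - 2 * f ^ α - 2 * r) * (1 - δ)) := rfl
  have hηle : exitFraction d f r α ≤ (1 - f ^ (1 - α)) * (1 - δ) := by
    rw [hη]
    exact mul_le_mul_of_nonneg_left (mul_le_of_le_one_left hδ1.le hq1) (by linarith)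
  have hηle' : exitFraction d f r α ≤ 1 - δ :=
    hηle.trans (mul_le_of_le_one_left hδ1.le (by linarith))
  -- averages of quantities which are large on the basin
  have havg : ∀ (g : S → ℝ) (c : ℝ), 0 ≤ c → (∀ x, 0 ≤ g x) → (∀ x ∈ B, c ≤ g x) →
      (1 - f ^ (1 - α)) * c ≤ ∑ x, M.restricted x * g x := by
    intro g c hc hg hgB
    refine (mul_le_mul_of_nonneg_right hmass hc).trans ?_
    rw [Finset.sum_mul]
    refine Finset.sum_le_sum fun x _ => ?_
    by_cases hx : x ∈ B
    · rw [Set.indicator_of_mem hx]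
      exact mul_le_mul_of_nonneg_left (hgB x hx) (M.restricted_nonneg x)
    · rw [Set.indicator_of_notMem hx, zero_mul]
      exact mul_nonneg (M.restricted_nonneg x) (hg x)
  have havg_le : ∀ (p g : S → ℝ), (∀ x, 0 ≤ p x) → ∑ x, p x = 1 → (∀ x, g x ≤ H) →
      ∑ x, p x * g x ≤ H := by
    intro p g hp hp1 hg
    calc ∑ x, p x * g x ≤ ∑ x, p x * H :=
          Finset.sum_le_sum fun x _ => mul_le_mul_of_nonneg_left (hg x) (hp x)
      _ = H := by rw [← Finset.sum_mul, hp1, one_mul]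
  choose ν s hν0 hν1 hνL hν using
    fun x : S => (hQ.isMetzler_killed M.G).exists_tendsto_normalized_row x
  have hquasi := M.quasiStationary_eq hν
  refine ⟨H, hHpos, fun x hx => ⟨?_, hx₁ x⟩, ⟨?_, ?_⟩, fun y => ?_, ?_⟩
  · exact (mul_le_mul_of_nonneg_right hηle' hH0).trans (hbasin x hx)
  · refine (mul_le_mul_of_nonneg_right hηle hH0).trans ?_
    rw [mul_assoc]
    exact havg h _ (by positivity) hnn hbasin
  · exact havg_le _ _ M.restricted_nonneg M.sum_restricted hx₁
  · rw [hquasi]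
    exact Finset.sum_nonneg fun x _ => mul_nonneg (M.restricted_nonneg x) (hν0 x y)
  -- The mean of `h` under `μ*_A` is the `π_A`-average over starting points `x` of its mean under `ν
  -- x`, so it is enough to treat `x` in the basin.
  · have hswap : ∑ y, M.quasiStationary y * h y =
        ∑ x, M.restricted x * ∑ y, ν x y * h y := by
      simp only [hquasi, Finset.sum_mul, Finset.mul_sum, mul_assoc]
      exact Finset.sum_comm
    rw [hswap]
    refine ⟨?_, havg_le _ _ M.restricted_nonneg M.sum_restricted
      fun x => havg_le _ _ (hν0 x) (hν1 x) hx₁⟩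
    rw [hη, mul_assoc]
    refine havg _ _ (by positivity)
      (fun x => Finset.sum_nonneg fun y _ => mul_nonneg (hν0 x y) (hnn y)) fun x hx => ?_
    have hνG : ∀ y ∈ M.G, ν x y = 0 := by
      intro y hy
      have hxy : x ≠ y := by rintro rfl; exact hBG x hx hy
      refine tendsto_nhds_unique (hν x y) (tendsto_const_nhds.congr fun t => ?_)
      rw [exp_killed_apply_of_mem_right _ hy, Matrix.one_apply_ne hxy, zero_div]
    -- One `r` is lost here, in the returns to the basin that control the decay rate. The second `r`
    -- of `exitFraction` is lost below, when the chain started from `ν x` must reach the basin.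
    have hdecay : 1 - 2 * f ^ α - r ≤ Real.exp (s x * R) := by
      refine Matrix.le_exp_eigenvalue (by linarith) (by linarith) (hν1 x) (hνL x) (hν x) fun k => ?_
      rw [← survival_eq_sum_exp _ (hBG x hx)]
      exact hQ.pow_le_survival hBG hR0 hr0.le hsurv2 hrec (by linarith) k x hx
    have := hh.le_sum_of_eigenvector hQ B hR0 (hν0 x) (hν1 x) hνG (hνL x) hdecay hrec
      (mul_nonneg hδ1.le hH0) hbasin
    refine le_of_eq_of_le ?_ this
    ring

end TrappedChain

/-- Two quantities between `η H` and `H` have a ratio between `η` and `1 / η`. Positivity of `H`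
makes the extended quotient agree with the real one. -/
lemma tendsto_ofReal_div_of_bounds {a b H η : ℕ → ℝ} (hη : Tendsto η atTop (𝓝 1))
    (hH : ∀ᶠ n in atTop, 0 < H n) (ha : ∀ᶠ n in atTop, η n * H n ≤ a n ∧ a n ≤ H n)
    (hb : ∀ᶠ n in atTop, η n * H n ≤ b n ∧ b n ≤ H n) :
    Tendsto (fun n => ENNReal.ofReal (a n) / ENNReal.ofReal (b n)) atTop (𝓝 1) := by
  have hη0 : ∀ᶠ n in atTop, 0 < η n := hη.eventually (lt_mem_nhds one_pos)
  have hbpos : ∀ᶠ n in atTop, 0 < b n := by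
    filter_upwards [hη0, hH, hb] with n h1 h2 h3
    exact (mul_pos h1 h2).trans_le h3.1
  have hlim : Tendsto (fun n => a n / b n) atTop (𝓝 1) := by
    have hinv : Tendsto (fun n => (η n)⁻¹) atTop (𝓝 1) := by simpa using hη.inv₀ one_ne_zero
    refine tendsto_of_tendsto_of_tendsto_of_le_of_le' hη hinv ?_ ?_
    · filter_upwards [hη0, hH, ha, hb, hbpos] with n h1 h2 h3 h4 h5
      rw [le_div_iff₀ h5]
      exact (mul_le_mul_of_nonneg_left h4.2 h1.le).trans h3.1
    · filter_upwards [hη0, hH, ha, hb, hbpos] with n h1 h2 h3 h4 h5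
      rw [div_le_iff₀ h5, ← div_eq_inv_mul, le_div_iff₀ h1, mul_comm]
      exact (mul_le_mul_of_nonneg_left h3.2 h1.le).trans h4.1
  have h1 := ENNReal.tendsto_ofReal hlim
  rw [ENNReal.ofReal_one] at h1
  refine h1.congr' ?_
  filter_upwards [hbpos] with n hn
  exact ENNReal.ofReal_div_of_pos hn

theorem corollary3p7 {S Ω : ℕ → Type*} [∀ n, Fintype (S n)] [∀ n, DecidableEq (S n)]
    [∀ n, MeasurableSpace (Ω n)] (M : ∀ n, TrappedChain (S n) (Ω n))
    (R : ℕ → ℝ≥0) (d f r : ℕ → ℝ) (α : ℝ) (hα : α ∈ Set.Ioo (0 : ℝ) 1)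
    (hyp : ∀ n, (M n).HpG (R n) (d n) (f n) (r n) α)
    (hd : Tendsto d atTop (𝓝 0)) (hf : Tendsto f atTop (𝓝 0)) (hr : Tendsto r atTop (𝓝 0)) :
    (∀ n y, Tendsto (fun t : ℝ≥0 => (M n).conditionedFrom (M n).restricted t y) atTop
      (𝓝 ((M n).quasiStationary y))) ∧
    ∀ x : ∀ n, S n, (∀ n, x n ∈ (M n).basin (R n) (f n) α) →
      Tendsto (fun n => (M n).meanExitFrom (M n).quasiStationary /
        (M n).meanExitFrom (M n).restricted) atTop (𝓝 1) ∧
      Tendsto (fun n => (M n).meanExitFrom (M n).restricted / (M n).meanExit (x n)) atTop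
        (𝓝 1) := by
  refine ⟨fun n y => (M n).tendsto_quasiStationary y, fun x hx => ?_⟩
  obtain ⟨hδ, hq, hη⟩ := TrappedChain.tendsto_exitFraction hα hd hf hr
  choose h hh using fun n => (M n).exists_isMeanTime
  -- The bounds require `basinError < 1` and `1 - 2 f^α - 2 r > 0`, which hold only for large `n`.
  have hev := (hδ.eventually (gt_mem_nhds one_pos)).and (hq.eventually (lt_mem_nhds one_pos))
  have hbounds := hev.mono fun n hn => (hyp n).exists_max_bounds hα hn.1 hn.2 (hh n)
  obtain ⟨H, hH⟩ := hbounds.choice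
  have h1 : ∀ᶠ n in atTop, (M n).meanExitFrom (M n).quasiStationary =
      ENNReal.ofReal (∑ y, (M n).quasiStationary y * h n y) :=
    hH.mono fun n hn => (M n).meanExitFrom_eq (hh n) hn.2.2.2.1
  have h2 : ∀ n, (M n).meanExitFrom (M n).restricted =
      ENNReal.ofReal (∑ y, (M n).restricted y * h n y) :=
    fun n => (M n).meanExitFrom_eq (hh n) (M n).restricted_nonneg
  have hpos := hH.mono fun n hn => hn.1
  have hres := hH.mono fun n hn => hn.2.2.1
  constructor
  · refine (tendsto_ofReal_div_of_bounds hη hpos (hH.mono fun n hn => hn.2.2.2.2) hres).congr' ?_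
    filter_upwards [h1] with n hn
    rw [hn, h2]
  · refine (tendsto_ofReal_div_of_bounds hη hpos hres
      (hH.mono fun n hn => hn.2.1 (x n) (hx n))).congr fun n => ?_
    rw [h2, (M n).meanExit_eq (hh n)]
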